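/- **Setting.** An instance is a finite set $J$ of $n\ge 1$ jobs; job $j$ has a release date $r_j\in\mathbb N$, a processing time $p_j\in\mathbb N$, $p_j\ge 1$, and a deadline $d_j\in\mathbb N$. In a feasible preemptive schedule each job $j$ is processed for exactly $p_j$ units of time within $[r_j,d_j]$; jobs may be preempted at any moment and resumed on any machine, a machine processes at most one job at a time, and no job runs on two machines at the same time. Let $m(J)$ be the minimum number of machines that admits a feasible schedule (we consider only instances that admit one on some number of machines), $J(t)=\{j\in J: r_j\le t\}$ and $m(t)=m(J(t))$. An online algorithm decides at integral times, and its decisions at time $t$ depend only on $J(t)$. EDF on $k$ machines processes during each slot $[t,t+1)$ the (at most) $k$ released unfinished jobs of smallest deadlines, ties being broken by earlier release date and then lower index. **The semi-online algorithm $\mathsf A(m)$**, with parameters $\alpha\in(0,1)$, $\lambda\in\mathbb R$ and $\mu:\mathbb N\to\mathbb N$, is given a number $m\ge m(J)$. Let $p_j(t)$ be the remaining processing time of $j$ at time $t$. Put $L_{-1}=\emptyset$, $L_t=L_{t-1}\cup\{j\in J(t): p_j(t)\le\alpha(d_j-t)\}$ (safe jobs) and $T_t=J(t)\setminus L_t$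 (critical jobs). * *Safe jobs.* A job $j$ that becomes safe at time $t$ is replaced by its residue, with release date $t$, processing time $p_j(t)$ and deadline $d_j$. The instance $L$ of all residues is scheduled by EDF on $\lceil \lambda m/(1-\alpha)^2\rceil$ separate machines. * *Critical jobs.* At each release date $t$, partition $T_t$ into sets $S_1,\dots,S_{h_t}$: consider the jobs of $T_t$ by non-increasing deadlines (ties in the reverse of the EDF order); job $j$ is added to an arbitrary existing set $S_i$ with $d_j-t\le d_a-t-p_a(t)$, where $a$ is the job of earliest deadline in $S_i$; if there is no such set, a new set $\{j\}$ is created. With $\mu_t=\mu(|J(t)|)$, write $S_i=\{j_1,j_2,\dots\}$ by increasing deadlines and split it into $S_i^k=\{j_l: l\equiv k-1 \bmod \mu_t\}$, $k=1,\dots,\mu_t$. At times that are not release dates, keep the partition of time $t-1$ and remove the jobs that have become safe (with $h_t=h_{t-1}$). Each of the $h_t\mu_t$ subsets is scheduled by EDF on a separate machine of its own. **Algorithm Double.** Let $t_0=\min_j r_j$ and $t_{i+1}=\min\{t: m(t)>2m(t_i)\}$, as long as such a time exists. The jobs with $r_j\in[t_i,t_{i+1})$ (with $t_{i+1}=\infty$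 if there is no such time) are scheduled by $\mathsf A(2m(t_i))$ on machines of their own, which are opened, from time $t_i$ on, when $\mathsf A(2m(t_i))$ needs them. **Theorem.** For every $\alpha\in(0,1)$ there are a function $\mu:\mathbb N\to\mathbb N$ and constants $\lambda, C$, depending only on $\alpha$, with $1\le\mu(N)\le C\log(N+1)$ for all $N\ge1$ (so $\mu_t=O(\log|J(t)|)$), such that the following holds however the arbitrary choices are made. 1. $\mathsf A(m)$ is an online algorithm for each given $m\in\mathbb N$. For every instance $J$ and every $m\ge m(J)$ we have $h_t\le C\,m$ at all times $t$, and $L$ admits a feasible schedule on $\lfloor\lambda m\rfloor$ machines. $\mathsf A(m)$ produces a feasible schedule of $J$ and opens at most $C\,\log(n+1)\,m$ machines in total. In particular, it is an $O(\log n)$-competitive algorithm for preemptive semi-online machine minimization. 2. Double, with $\mathsf A$ as its semi-online algorithm, is an online algorithm, produces a feasible schedule of every instance $J$, and opens at most $C\,\log(n+1)\,m(J)$ machines in total. That is, it is $O(\log n)$-competitive for preemptive online machine minimization. (The bounds are written with $\log(n+1)$ instead of $\log n$ only in order to include $n=1$.) -/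

import Mathlib

namespace MachineMin

/-- A finite set of jobs with integral release dates `r`, processing times `p` and deadlines `d`.
Jobs are named by natural numbers (their indices); only the data of members of `jobs` matter. -/
structure Instance where
  jobs : Finset ℕ
  r : ℕ → ℕ
  p : ℕ → ℕ
  d : ℕ → ℕ

namespace Instance

/-- `J(t)`: the jobs released by time `t`. -/
def upTo (J : Instance) (t : ℕ) : Instance :=
  { J with jobs := J.jobs.filter fun j => J.r j ≤ t }

end Instance

/-! ### Preemptive schedules in continuous time and the optimum -/

/-- `σ q x` is the job (if any) that machine `q` processes at the real time `x`. `Feasible J M σ`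
says that `σ` is a feasible preemptive schedule (with migration) of `J` that uses only machines
in `M`. A machine processes at most one job at a time because `σ q x` has a single value. -/
structure Feasible {κ : Type} (J : Instance) (M : Set κ) (σ : κ → ℝ → Option ℕ) : Prop where
  machine_mem : ∀ q x j, σ q x = some j → q ∈ M
  job_mem : ∀ q x j, σ q x = some j → j ∈ J.jobs
  window : ∀ q x j, σ q x = some j → (J.r j : ℝ) ≤ x ∧ x ≤ (J.d j : ℝ)
  not_parallel : ∀ q q' x j, σ q x = some j → σ q' x = some j → q = q'
  measurable : ∀ q j, MeasurableSet {x : ℝ | σ q x = some j}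
  amount : ∀ j ∈ J.jobs, MeasureTheory.volume {x : ℝ | ∃ q, σ q x = some j} = (J.p j : ENNReal)

/-- `J` can be scheduled feasibly on `k` machines. -/
def FeasibleOn (J : Instance) (k : ℕ) : Prop :=
  ∃ σ : Fin k → ℝ → Option ℕ, Feasible J Set.univ σ

/-- `m(J)`: the minimum number of machines needed to schedule `J`. It is used only for instances
that can be scheduled on some number of machines. -/
noncomputable def opt (J : Instance) : ℕ := sInf {k | FeasibleOn J k}

/-- The inputs of the problem: positive processing times, and some number of machines suffices. -/
def Admissible (J : Instance) : Prop :=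
  (∀ j ∈ J.jobs, 0 < J.p j) ∧ ∃ k, FeasibleOn J k

/-! ### Online algorithms -/

/-- An algorithm that decides at integral times. `slot J q t` is the job it processes on machine
`q` during `[t, t+1)`, and `opened J t` is the set of machines it has opened by time `t`. -/
structure Algorithm (κ : Type) where
  slot : Instance → κ → ℕ → Option ℕ
  opened : Instance → ℕ → Set κ

/-- The same jobs, with the same data, are released in `J` and in `J'` by time `t`. -/
def AgreeUpTo (J J' : Instance) (t : ℕ) : Prop :=
  (J.upTo t).jobs = (J'.upTo t).jobs ∧
    ∀ j ∈ (J.upTo t).jobs, J.r j = J'.r j ∧ J.p j = J'.p j ∧ J.d j = J'.d j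

namespace Algorithm

variable {κ : Type}

/-- The algorithm is online: what it does at time `t` depends only on the jobs released
by time `t`. -/
def IsOnline (A : Algorithm κ) : Prop :=
  ∀ J J' : Instance, Admissible J → Admissible J' → ∀ t, AgreeUpTo J J' t →
    (∀ q, A.slot J q t = A.slot J' q t) ∧ A.opened J t = A.opened J' t

/-- The schedule in real time. -/
noncomputable def schedule (A : Algorithm κ) (J : Instance) (q : κ) (x : ℝ) : Option ℕ :=
  if 0 ≤ x then A.slot J q ⌊x⌋₊ else none

/-- All machines that are ever opened. -/
def machines (A : Algorithm κ) (J : Instance) : Set κ := {q | ∃ t, q ∈ A.opened J t}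

/-- The algorithm finds a feasible schedule of `J`, uses a machine only once it has been opened,
and opens at most `B` machines in total. -/
def SolvesWith (A : Algorithm κ) (J : Instance) (B : ℝ) : Prop :=
  Feasible J (A.machines J) (A.schedule J) ∧
    (∀ q t j, A.slot J q t = some j → q ∈ A.opened J t) ∧
    (A.machines J).Finite ∧ ((A.machines J).ncard : ℝ) ≤ B

end Algorithm

/-! ### Earliest Deadline First -/

namespace Instance

/-- The jobs in `A` by increasing deadline; ties are broken by release date, then by index. -/
def edfSort (J : Instance) (A : Finset ℕ) : List ℕ :=
  ((A.image fun j => (toLex (J.d j, toLex (J.r j, j)) : ℕ ×ₗ ℕ ×ₗ ℕ)).sort (· ≤ ·)).map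
    fun k => (ofLex (ofLex k).2).2

/-- Given remaining processing times `rem` at time `t`, the jobs that EDF on `K` machines processes
during `[t, t+1)`: the first `K` active (released, unfinished) jobs. -/
def edfQueue (J : Instance) (K : ℕ) (rem : ℕ → ℕ) (t : ℕ) : List ℕ :=
  (J.edfSort (J.jobs.filter fun j => J.r j ≤ t ∧ 0 < rem j)).take K

/-- Remaining processing times at time `t` when EDF is run on `K` machines. -/
def edfRem (J : Instance) (K : ℕ) : ℕ → ℕ → ℕ
  | 0 => J.p
  | t + 1 => fun j =>
      if j ∈ J.edfQueue K (J.edfRem K t) t then J.edfRem K t j - 1 else J.edfRem K t j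

/-- The job that EDF on `K` machines processes on machine `q` during `[t, t+1)`. -/
def edfSlot (J : Instance) (K q t : ℕ) : Option ℕ :=
  (J.edfQueue K (J.edfRem K t) t)[q]?

end Instance

/-! ### The treatment of critical jobs -/

/-- State at time `t`, after the decisions at time `t` have been made. `rem j` is `p_j(t)`
(for a safe job, frozen at the time at which it became safe), `safe` is `L_t`, and `parts` is the
list of the sets `S_1, ..., S_{h_t}`, each of them given as the list of its subsets
`S_i^1, ..., S_i^{μ_t}`. -/
structure CritState where
  rem : ℕ → ℕ
  safe : Finset ℕ
  parts : List (List (Finset ℕ))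

/-- `j` may be added to a set whose job of earliest deadline is `a`:
`d_j - t ≤ ℓ_a(t) = d_a - t - p_a(t)`. -/
def Fits (J : Instance) (rem : ℕ → ℕ) (t j a : ℕ) : Prop :=
  (J.d j : ℤ) - t ≤ (J.d a : ℤ) - t - rem a

/-- A rule for the arbitrary choices: `pick t j c` selects, at time `t` and for job `j`, one of the
admissible sets; `c` is the (nonempty) set of their numbers. -/
def IsChoiceRule (pick : ℕ → ℕ → Finset ℕ → ℕ) : Prop :=
  ∀ t j c, c.Nonempty → pick t j c ∈ c

open scoped Classical in
/-- The numbers of the existing sets to which `j` may be added. Jobs are added in the order of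
non-increasing deadlines at the head of the lists, so the head of a list is its job of earliest
deadline. -/
noncomputable def candidates (J : Instance) (rem : ℕ → ℕ) (t : ℕ) (S : List (List ℕ)) (j : ℕ) :
    Finset ℕ :=
  (Finset.range S.length).filter fun i => ∃ a, (S[i]?.bind List.head?) = some a ∧ Fits J rem t j a

open scoped Classical in
/-- Add `j` to an admissible existing set, or open a new one if there is none. -/
noncomputable def greedyAdd (J : Instance) (pick : ℕ → ℕ → Finset ℕ → ℕ) (rem : ℕ → ℕ) (t : ℕ)
    (S : List (List ℕ)) (j : ℕ) : List (List ℕ) :=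
  if (candidates J rem t S j).Nonempty then
    S.modify (pick t j (candidates J rem t S j)) (fun l => j :: l)
  else S ++ [[j]]

/-- The partition of the critical jobs `T` into `S_1, ..., S_{h_t}`, each listed by increasing
deadlines; the jobs are considered by non-increasing deadlines. -/
noncomputable def greedySets (J : Instance) (pick : ℕ → ℕ → Finset ℕ → ℕ) (rem : ℕ → ℕ) (t : ℕ)
    (T : Finset ℕ) : List (List ℕ) :=
  (J.edfSort T).reverse.foldl (greedyAdd J pick rem t) []

/-- The subsets `S^k = {j_i | i ≡ k - 1 mod μ}`, `k = 1, ..., μ`, of `S = {j_1, j_2, ...}`. -/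
def splitSet (μ : ℕ) (S : List ℕ) : List (Finset ℕ) :=
  (List.range μ).map fun k => S.toFinset.filter fun j => (S.idxOf j + 1) % μ = k

open scoped Classical in
/-- The decisions at time `t`, given the remaining processing times `rem` at time `t`, the set
`safe = L_{t-1}` and the previous partition: reclassify the jobs; at a release date, partition the
critical jobs anew, and otherwise take over the partition and remove the safe jobs. -/
noncomputable def critDecide (J : Instance) (α : ℝ) (μ : ℕ → ℕ) (pick : ℕ → ℕ → Finset ℕ → ℕ)
    (t : ℕ) (rem : ℕ → ℕ) (safe : Finset ℕ) (parts : List (List (Finset ℕ))) : CritState :=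
  let released := (J.upTo t).jobs
  let safe' := safe ∪ released.filter fun j => (rem j : ℝ) ≤ α * ((J.d j : ℝ) - t)
  { rem := rem
    safe := safe'
    parts :=
      if ∃ j ∈ J.jobs, J.r j = t then
        (greedySets J pick rem t (released \ safe')).map (splitSet (μ released.card))
      else parts.map fun Si => Si.map fun A => A \ safe' }

/-- The machines of the critical jobs: one for each subset `S_i^k`, on which EDF is run. The `q`-th
entry is the job processed by the `q`-th of these machines. -/
def CritState.running (J : Instance) (s : CritState) : List (Option ℕ) :=
  s.parts.flatten.map fun A => (J.edfSort A).head?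

/-- The evolution of the classification, of the partition and of the remaining processing times. -/
noncomputable def critState (J : Instance) (α : ℝ) (μ : ℕ → ℕ) (pick : ℕ → ℕ → Finset ℕ → ℕ) :
    ℕ → CritState
  | 0 => critDecide J α μ pick 0 J.p ∅ []
  | t + 1 =>
      let s := critState J α μ pick t
      critDecide J α μ pick (t + 1)
        (fun j => if some j ∈ s.running J then s.rem j - 1 else s.rem j) s.safe s.parts

open scoped Classical in
/-- The instance `L` of residues: a job that becomes safe at time `t` is released at time `t` with
its remaining processing time `p_j(t)` and its original deadline. -/
noncomputable def safeInstance (J : Instance) (α : ℝ) (μ : ℕ → ℕ)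
    (pick : ℕ → ℕ → Finset ℕ → ℕ) : Instance :=
  { jobs := J.jobs.filter fun j => ∃ t, j ∈ (critState J α μ pick t).safe
    r := fun j => sInf {t | j ∈ (critState J α μ pick t).safe}
    p := fun j =>
      (critState J α μ pick (sInf {t | j ∈ (critState J α μ pick t).safe})).rem j
    d := J.d }

/-- The semi-online algorithm for a given number `m`, which is meant to be the optimum or an upper
bound on it. Machines `0, ..., K - 1`, where `K = ⌈lam * m / (1 - α)^2⌉`, run EDF on the safe jobs;
the machines from `K` on run EDF on the subsets of critical jobs. -/
noncomputable def semiOnline (α : ℝ) (μ : ℕ → ℕ) (lam : ℝ) (pick : ℕ → ℕ → Finset ℕ → ℕ)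
    (m : ℕ) : Algorithm ℕ :=
  let K : ℕ := ⌈lam * m / (1 - α) ^ 2⌉₊
  { slot := fun J q t =>
      if q < K then (safeInstance J α μ pick).edfSlot K q t
      else (((critState J α μ pick t).running J)[q - K]?).join
    opened := fun J t =>
      {q | q < K ∨ ∃ s ≤ t, q < K + (critState J α μ pick s).parts.flatten.length} }

/-! ### The doubling reduction -/

/-- `t_0 = min r_j` and `t_{i+1} = min {t | m(t) > 2 m(t_i)}`, with value `⊤` if there is no such
time. -/
noncomputable def phaseStart (J : Instance) : ℕ → ℕ∞
  | 0 => ⨅ j ∈ J.jobs, (J.r j : ℕ∞)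
  | i + 1 => ⨅ (t : ℕ) (_ : ∃ s : ℕ, phaseStart J i = s ∧ 2 * opt (J.upTo s) < opt (J.upTo t)),
      (t : ℕ∞)

open scoped Classical in
/-- The jobs with release date in `[t_i, t_{i+1})`. -/
noncomputable def phase (J : Instance) (i : ℕ) : Instance :=
  { J with jobs := J.jobs.filter fun j =>
      phaseStart J i ≤ (J.r j : ℕ∞) ∧ (J.r j : ℕ∞) < phaseStart J (i + 1) }

/-- `2 m(t_i)`. -/
noncomputable def phaseGuess (J : Instance) (i : ℕ) : ℕ :=
  2 * opt (J.upTo (phaseStart J i).toNat)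

/-- Algorithm Double: the jobs of the `i`-th phase are scheduled by the semi-online algorithm with
parameter `2 m(t_i)` on machines of their own, the machines `(i, q)`. -/
noncomputable def double {κ : Type} (A : ℕ → Algorithm κ) : Algorithm (ℕ × κ) where
  slot J iq t := (A (phaseGuess J iq.1)).slot (phase J iq.1) iq.2 t
  opened J t := {iq | phaseStart J iq.1 ≤ (t : ℕ∞) ∧
    iq.2 ∈ (A (phaseGuess J iq.1)).opened (phase J iq.1) t}

end MachineMin

/-!
All bounds are in terms of the optimum through one fact, the load bound `FeasibleOn.sum_forced_le`:
within an interval `[u, v]`, the `m` machines of a feasible schedule do at most `m * (v - u)` units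
of work, and job `j` needs at least `p - (u - r)⁺ - (d - v)⁺` of them.

*Critical jobs keep half of their laxity.* In a set built by the greedy procedure, the window of a
job is at most the laxity of the next one, which, for a critical job, is less than `1 - α` times
its own window. Windows thus grow geometrically along a set, and of two jobs in the same one of the
`μ` subsets the earlier one has a window of at most `(1 - α) ^ (μ - 1)` times the laxity of the
later one (`window_le_of_mem_splitSet`). EDF delays a job only while an earlier job of its subset
is unfinished, so until the next release date a job loses at most this fraction of its laxity. With
`(1 - α) ^ (μ - 1) ≤ 1 / (N + 1) ^ 2`, where `N` is the number of jobs released so far, the losses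
telescope: `(1 - 1 / (N + 1) ^ 2) * laxFraction N = laxFraction (N + 1)`, and `laxFraction` is
at least one half. This is the invariant `CritInv`. In particular, no critical job misses its deadline.

*Few sets.* When a job `j` with remaining window `D` opens a new set, the earliest job of each
existing set has laxity less than `D` and a remaining processing time of more than `α * D`. Its
laxity at release was less than `2 * D`, so it is forced to receive `α * D` units of work within
distance `3 * D` of the current time. By the load bound there are at most `6 * opt J / α` such jobs
(`card_le_of_not_fits`).

*Safe jobs.* Since a residue has at least half of the laxity of the original job, the residues
whose windows lie in `[a, b]` belong to jobs that are forced to receive as much work within `[b - 4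
* (b - a), b]`; so their load is at most `4 * opt J` (`sum_residues_le`). For loose jobs such a
bound on the load of every interval already makes EDF succeed on `O(opt J)` machines
(`Instance.edfRem_deadline_eq_zero`): with respect to a deadline `d`, the backlog at time `t` stays
proportional to `d - t` (`Instance.edfBacklog_le`), because a loose job that is still unfinished
late in its window has been waiting for a constant fraction of it, and all machines were busy
meanwhile. As EDF on any such number of machines is feasible, this also bounds the optimum of the
residues.

*Online.* Every quantity that the algorithm uses at time `t` is shown to be equal for instances
that agree up to time `t`. For Double the guesses more than double from phase to phase, so their
sum is at most `4 * opt J` (`sum_phaseGuess_le`), while the optimum of a phase is at most its guess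
(`opt_phase_le`).
-/

namespace MachineMin

open MeasureTheory

/-! ### The EDF order -/

namespace Instance

/-- The sorting key of the EDF order: deadline, then release date, then index. -/
def edfKey (J : Instance) (j : ℕ) : ℕ ×ₗ ℕ ×ₗ ℕ := toLex (J.d j, toLex (J.r j, j))

theorem deadline_le_of_edfKey_le {J : Instance} {a b : ℕ} (h : J.edfKey a ≤ J.edfKey b) :
    J.d a ≤ J.d b := by
  rcases Prod.Lex.le_iff.1 h with h | h
  · exact le_of_lt h
  · exact le_of_eq h.1

theorem mem_edfSort {J : Instance} {A : Finset ℕ} {j : ℕ} : j ∈ J.edfSort A ↔ j ∈ A := by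
  simp [edfSort]

theorem pairwise_edfSort (J : Instance) (A : Finset ℕ) :
    (J.edfSort A).Pairwise fun a b => J.edfKey a < J.edfKey b := by
  unfold edfSort
  rw [List.pairwise_map]
  refine List.Pairwise.imp_of_mem ?_ (Finset.sortedLT_sort (A.image J.edfKey)).pairwise
  intro x y hx hy hxy
  obtain ⟨a, -, rfl⟩ := Finset.mem_image.1 ((Finset.mem_sort _).1 hx)
  obtain ⟨b, -, rfl⟩ := Finset.mem_image.1 ((Finset.mem_sort _).1 hy)
  exact hxy

theorem nodup_edfSort (J : Instance) (A : Finset ℕ) : (J.edfSort A).Nodup :=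
  (J.pairwise_edfSort A).imp fun h e => by simp [e] at h

theorem edfSort_congr {J J' : Instance} {A : Finset ℕ}
    (h : ∀ j ∈ A, J.r j = J'.r j ∧ J.d j = J'.d j) : J.edfSort A = J'.edfSort A := by
  unfold edfSort
  congr 2
  refine Finset.image_congr fun j hj => ?_
  rw [(h j hj).1, (h j hj).2]

theorem mem_of_head?_edfSort {J : Instance} {A : Finset ℕ} {b : ℕ}
    (h : (J.edfSort A).head? = some b) : b ∈ A :=
  mem_edfSort.1 (List.mem_of_mem_head? h)

/-- A member of `A` that is not the first one in the EDF order comes after the first one. -/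
theorem exists_head?_edfSort {J : Instance} {A : Finset ℕ} {c : ℕ} (hc : c ∈ A)
    (h : (J.edfSort A).head? ≠ some c) :
    ∃ b, (J.edfSort A).head? = some b ∧ J.edfKey b < J.edfKey c := by
  have hc' := mem_edfSort (J := J).2 hc
  have hp := J.pairwise_edfSort A
  cases hl : J.edfSort A with
  | nil => simp [hl] at hc'
  | cons b l =>
    rw [hl] at hc' hp h
    refine ⟨b, rfl, ?_⟩
    rcases List.mem_cons.1 hc' with rfl | hcl
    · simp at h
    · exact (List.pairwise_cons.1 hp).1 c hcl

theorem nodup_edfQueue (J : Instance) (K : ℕ) (rem : ℕ → ℕ) (t : ℕ) :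
    (J.edfQueue K rem t).Nodup :=
  (J.nodup_edfSort _).sublist (List.take_sublist _ _)

theorem active_of_mem_edfQueue {J : Instance} {K : ℕ} {rem : ℕ → ℕ} {t j : ℕ}
    (h : j ∈ J.edfQueue K rem t) : j ∈ J.jobs ∧ J.r j ≤ t ∧ 0 < rem j := by
  have := mem_edfSort.1 (List.mem_of_mem_take h)
  simpa using this

/-- If EDF does not process an active job, then all machines are busy with jobs of no later
deadline. -/
theorem edfQueue_busy {J : Instance} {K : ℕ} {rem : ℕ → ℕ} {t j : ℕ} (hj : j ∈ J.jobs)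
    (hr : J.r j ≤ t) (hrem : 0 < rem j) (h : j ∉ J.edfQueue K rem t) :
    (J.edfQueue K rem t).length = K ∧ ∀ i ∈ J.edfQueue K rem t, J.d i ≤ J.d j := by
  have hmem : j ∈ J.edfSort (J.jobs.filter fun j => J.r j ≤ t ∧ 0 < rem j) :=
    mem_edfSort.2 (by simp [hj, hr, hrem])
  have hp := J.pairwise_edfSort (J.jobs.filter fun j => J.r j ≤ t ∧ 0 < rem j)
  unfold edfQueue at h ⊢
  set l := J.edfSort (J.jobs.filter fun j => J.r j ≤ t ∧ 0 < rem j)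
  rw [← List.take_append_drop K l, List.mem_append] at hmem
  have hd := hmem.resolve_left h
  rw [← List.take_append_drop K l, List.pairwise_append] at hp
  refine ⟨?_, fun i hi => deadline_le_of_edfKey_le (hp.2.2 i hi j hd).le⟩
  have : 0 < (l.drop K).length := List.length_pos_of_mem hd
  rw [List.length_drop] at this
  rw [List.length_take]
  omega

end Instance

/-! ### Schedules that change only at integral times -/

theorem measurableSet_floor_mem (P : ℕ → Prop) :
    MeasurableSet {x : ℝ | 0 ≤ x ∧ P ⌊x⌋₊} :=
  measurableSet_Ici.inter (Nat.measurable_floor (MeasurableSet.of_discrete (s := {t | P t})))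

theorem volume_floor_mem (F : Finset ℕ) :
    volume {x : ℝ | 0 ≤ x ∧ ⌊x⌋₊ ∈ F} = (F.card : ENNReal) := by
  have h : {x : ℝ | 0 ≤ x ∧ ⌊x⌋₊ ∈ F} = ⋃ t ∈ F, Set.Ico (t : ℝ) (t + 1) := by
    ext x
    simp only [Set.mem_ofPred_eq, Set.mem_iUnion, Set.mem_Ico, exists_prop]
    constructor
    · rintro ⟨h0, hF⟩
      exact ⟨_, hF, Nat.floor_le h0, Nat.lt_floor_add_one x⟩
    · rintro ⟨t, ht, h1, h2⟩
      have h0 : (0 : ℝ) ≤ x := le_trans (Nat.cast_nonneg t) h1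
      exact ⟨h0, by rwa [(Nat.floor_eq_iff h0).2 ⟨h1, h2⟩]⟩
  rw [h, measure_biUnion_finset]
  · simp
  · intro a _ b _ hab
    rw [Function.onFun, Set.disjoint_left]
    rintro x ⟨h1, h2⟩ ⟨h3, h4⟩
    have h0 : (0 : ℝ) ≤ x := le_trans (Nat.cast_nonneg a) h1
    exact hab (((Nat.floor_eq_iff h0).2 ⟨h1, h2⟩).symm.trans ((Nat.floor_eq_iff h0).2 ⟨h3, h4⟩))
  · exact fun _ _ => measurableSet_Ico

/-- A schedule given by slots is feasible if the slots of each job lie in its window, are as many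
as its processing time, and are on one machine at a time. -/
theorem feasible_of_slots {κ : Type} {J : Instance} {M : Set κ} {slot : κ → ℕ → Option ℕ}
    (hM : ∀ q t j, slot q t = some j → q ∈ M)
    (hJ : ∀ q t j, slot q t = some j → j ∈ J.jobs ∧ J.r j ≤ t ∧ t + 1 ≤ J.d j)
    (hpar : ∀ q q' t j, slot q t = some j → slot q' t = some j → q = q')
    (hamount : ∀ j ∈ J.jobs, ∃ F : Finset ℕ,
      F.card = J.p j ∧ ∀ t, t ∈ F ↔ ∃ q, slot q t = some j) :
    Feasible J M fun q (x : ℝ) => if 0 ≤ x then slot q ⌊x⌋₊ else none := by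
  have key : ∀ q (x : ℝ) j, (if 0 ≤ x then slot q ⌊x⌋₊ else none) = some j ↔
      0 ≤ x ∧ slot q ⌊x⌋₊ = some j := by
    intro q x j
    split_ifs with h <;> simp [h]
  constructor
  · intro q x j h
    exact hM _ _ _ ((key _ _ _).1 h).2
  · intro q x j h
    exact (hJ _ _ _ ((key _ _ _).1 h).2).1
  · intro q x j h
    obtain ⟨h0, h⟩ := (key _ _ _).1 h
    obtain ⟨-, h1, h2⟩ := hJ _ _ _ h
    constructor
    · exact le_trans (by exact_mod_cast h1) (Nat.floor_le h0)
    · exact (Nat.lt_floor_add_one x).le.trans (by exact_mod_cast h2)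
  · intro q q' x j h h'
    exact hpar _ _ _ _ ((key _ _ _).1 h).2 ((key _ _ _).1 h').2
  · intro q j
    simp only [key]
    exact measurableSet_floor_mem fun t => slot q t = some j
  · intro j hj
    obtain ⟨F, hF, hFm⟩ := hamount j hj
    rw [← hF, ← volume_floor_mem]
    congr 1
    ext x
    simp only [key, Set.mem_ofPred_eq, hFm]
    constructor
    · rintro ⟨q, h0, h⟩
      exact ⟨h0, q, h⟩
    · rintro ⟨h0, q, h⟩
      exact ⟨q, h0, h⟩

/-! ### The optimum -/

namespace Feasible

variable {κ : Type} {J : Instance} {M : Set κ} {σ : κ → ℝ → Option ℕ}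

/-- A job is processed for at least `p - (u - r)⁺ - (d - v)⁺` time units within `[u, v]`. -/
theorem le_volume_busy_inter (h : Feasible J M σ) {j : ℕ} (hj : j ∈ J.jobs) {u v w : ℕ}
    (hw : w + (u - J.r j) + (J.d j - v) ≤ J.p j) :
    (w : ENNReal) ≤ volume ({x : ℝ | ∃ q, σ q x = some j} ∩ Set.Icc (u : ℝ) v) := by
  set B := {x : ℝ | ∃ q, σ q x = some j}
  have hsub : B ⊆ (B ∩ Set.Icc (u : ℝ) v) ∪ (Set.Ico (J.r j : ℝ) u ∪ Set.Ioc (v : ℝ) (J.d j)) := by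
    rintro x ⟨q, hq⟩
    have hwin := h.window q x j hq
    by_cases h1 : x < u
    · exact Or.inr (Or.inl ⟨hwin.1, h1⟩)
    · by_cases h2 : (v : ℝ) < x
      · exact Or.inr (Or.inr ⟨h2, hwin.2⟩)
      · exact Or.inl ⟨⟨q, hq⟩, not_lt.1 h1, not_lt.1 h2⟩
  have e : ∀ a b : ℕ, ENNReal.ofReal ((b : ℝ) - a) = ((b - a : ℕ) : ENNReal) := by
    intro a b
    rw [ENNReal.natCast_sub, ENNReal.ofReal_sub _ (Nat.cast_nonneg _), ENNReal.ofReal_natCast,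
      ENNReal.ofReal_natCast]
  have h1 : (J.p j : ENNReal) ≤ volume (B ∩ Set.Icc (u : ℝ) v) +
      (((u - J.r j : ℕ) : ENNReal) + ((J.d j - v : ℕ) : ENNReal)) := by
    rw [← h.amount j hj]
    refine (measure_mono hsub).trans ((measure_union_le _ _).trans ?_)
    gcongr
    refine (measure_union_le _ _).trans ?_
    rw [Real.volume_Ico, Real.volume_Ioc, e, e]
  have h2 : (w : ENNReal) + (((u - J.r j : ℕ) : ENNReal) + ((J.d j - v : ℕ) : ENNReal)) ≤
      (J.p j : ENNReal) := by
    rw [← add_assoc]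
    exact_mod_cast hw
  refine (ENNReal.add_le_add_iff_right ?_).1 (h2.trans h1)
  exact ENNReal.add_ne_top.2 ⟨ENNReal.natCast_ne_top _, ENNReal.natCast_ne_top _⟩

theorem release_add_le_deadline (h : Feasible J M σ) {j : ℕ} (hj : j ∈ J.jobs) (hp : 0 < J.p j) :
    J.r j + J.p j ≤ J.d j := by
  have h1 : (J.p j : ENNReal) ≤ volume (Set.Icc (J.r j : ℝ) (J.d j)) := by
    rw [← h.amount j hj]
    refine measure_mono ?_
    rintro x ⟨q, hq⟩
    exact h.window q x j hq
  rw [Real.volume_Icc, ENNReal.ofReal_sub _ (Nat.cast_nonneg _), ENNReal.ofReal_natCast,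
    ENNReal.ofReal_natCast, ← ENNReal.natCast_sub] at h1
  have h2 : J.p j ≤ J.d j - J.r j := by exact_mod_cast h1
  omega

end Feasible

/-- The load bound: on `m` machines, the work that the jobs of `S` are forced to receive within
`[u, v]` is at most `m * (v - u)`. -/
theorem FeasibleOn.sum_forced_le {J : Instance} {m : ℕ} (h : FeasibleOn J m) {u v : ℕ}
    {S : Finset ℕ} (hS : S ⊆ J.jobs) (w : ℕ → ℕ)
    (hw : ∀ j ∈ S, w j + (u - J.r j) + (J.d j - v) ≤ J.p j) :
    ∑ j ∈ S, w j ≤ m * (v - u) := by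
  obtain ⟨σ, hσ⟩ := h
  have h1 : ∑ j ∈ S, (w j : ENNReal) ≤
      ∑ j ∈ S, ∑ q : Fin m, volume ({x : ℝ | σ q x = some j} ∩ Set.Icc (u : ℝ) v) := by
    refine Finset.sum_le_sum fun j hj => ?_
    refine (hσ.le_volume_busy_inter (hS hj) (hw j hj)).trans ?_
    refine le_trans (measure_mono ?_) (measure_iUnion_fintype_le _ _)
    rintro x ⟨⟨q, hq⟩, hx⟩
    exact Set.mem_iUnion.2 ⟨q, hq, hx⟩
  rw [Finset.sum_comm] at h1
  have h2 : ∀ q : Fin m, ∑ j ∈ S, volume ({x : ℝ | σ q x = some j} ∩ Set.Icc (u : ℝ) v) ≤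
      ((v - u : ℕ) : ENNReal) := by
    intro q
    rw [← measure_biUnion_finset]
    · refine (measure_mono (t := Set.Icc (u : ℝ) v) ?_).trans ?_
      · intro x hx
        simp only [Set.mem_iUnion] at hx
        obtain ⟨j, -, hx⟩ := hx
        exact hx.2
      · rw [Real.volume_Icc, ENNReal.natCast_sub, ENNReal.ofReal_sub _ (Nat.cast_nonneg _),
          ENNReal.ofReal_natCast, ENNReal.ofReal_natCast]
    · intro a _ b _ hab
      rw [Function.onFun, Set.disjoint_left]
      rintro x ⟨h3, -⟩ ⟨h4, -⟩
      rw [Set.mem_ofPred_eq] at h3 h4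
      exact hab (Option.some.inj (h3.symm.trans h4))
    · exact fun j _ => (hσ.measurable q j).inter measurableSet_Icc
  have h3 := h1.trans (Finset.sum_le_sum fun q _ => h2 q)
  rw [Finset.sum_const, Finset.card_univ, Fintype.card_fin, nsmul_eq_mul] at h3
  exact_mod_cast h3

/-- `J'` is a part of `J`: some of its jobs, with the same data. -/
def SubInstance (J' J : Instance) : Prop :=
  J'.jobs ⊆ J.jobs ∧ ∀ j ∈ J'.jobs, J.r j = J'.r j ∧ J.p j = J'.p j ∧ J.d j = J'.d j

theorem FeasibleOn.of_subInstance {J J' : Instance} {k : ℕ} (h : FeasibleOn J k)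
    (hs : SubInstance J' J) : FeasibleOn J' k := by
  obtain ⟨σ, hσ⟩ := h
  have key : ∀ q x j, (σ q x).filter (fun i => decide (i ∈ J'.jobs)) = some j ↔
      σ q x = some j ∧ j ∈ J'.jobs := by
    intro q x j
    rw [Option.filter_eq_some_iff]
    simp
  refine ⟨fun q x => (σ q x).filter fun i => decide (i ∈ J'.jobs), ?_⟩
  constructor
  · intro q x j _
    trivial
  · intro q x j hj
    exact ((key _ _ _).1 hj).2
  · intro q x j hj
    obtain ⟨h1, h2⟩ := (key _ _ _).1 hj
    have h3 := hσ.window q x j h1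
    rwa [(hs.2 j h2).1, (hs.2 j h2).2.2] at h3
  · intro q q' x j h1 h2
    exact hσ.not_parallel q q' x j ((key _ _ _).1 h1).1 ((key _ _ _).1 h2).1
  · intro q j
    simp only [key]
    by_cases hj : j ∈ J'.jobs
    · simpa [hj] using hσ.measurable q j
    · simp [hj]
  · intro j hj
    simp only [key, hj, and_true]
    rw [hσ.amount j (hs.1 hj), (hs.2 j hj).2.1]

theorem Admissible.of_subInstance {J J' : Instance} (h : Admissible J) (hs : SubInstance J' J) :
    Admissible J' :=
  ⟨fun j hj => (hs.2 j hj).2.1 ▸ h.1 j (hs.1 hj),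
    h.2.imp fun _ hk => hk.of_subInstance hs⟩

theorem Admissible.feasibleOn_opt {J : Instance} (h : Admissible J) : FeasibleOn J (opt J) :=
  Nat.sInf_mem (s := {k | FeasibleOn J k}) h.2

theorem opt_le {J : Instance} {k : ℕ} (h : FeasibleOn J k) : opt J ≤ k :=
  Nat.sInf_le h

theorem opt_mono {J J' : Instance} (h : Admissible J) (hs : SubInstance J' J) :
    opt J' ≤ opt J :=
  opt_le (h.feasibleOn_opt.of_subInstance hs)

theorem Admissible.release_add_le_deadline {J : Instance} (h : Admissible J) {j : ℕ}
    (hj : j ∈ J.jobs) : J.r j + J.p j ≤ J.d j := by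
  obtain ⟨σ, hσ⟩ := h.feasibleOn_opt
  exact hσ.release_add_le_deadline hj (h.1 j hj)

theorem Admissible.one_le_opt {J : Instance} (h : Admissible J) (hne : J.jobs.Nonempty) :
    1 ≤ opt J := by
  by_contra h0
  obtain ⟨j, hj⟩ := hne
  obtain ⟨σ, hσ⟩ := h.feasibleOn_opt
  have h1 := hσ.amount j hj
  have h2 : {x : ℝ | ∃ q, σ q x = some j} = ∅ := by
    ext x
    simp only [Set.mem_ofPred_eq, Set.mem_empty_iff_false, iff_false, not_exists]
    intro q
    exact absurd q.2 (by omega)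
  rw [h2, measure_empty] at h1
  have h3 := h.1 j hj
  have h4 : J.p j = 0 := by exact_mod_cast h1.symm
  omega


/-! ### EDF on loose jobs -/

namespace Instance

variable {J : Instance} {K : ℕ}

theorem edfRem_eq_succ_add (J : Instance) (K t i : ℕ) :
    J.edfRem K t i = J.edfRem K (t + 1) i + if i ∈ J.edfQueue K (J.edfRem K t) t then 1 else 0 := by
  simp only [edfRem]
  split_ifs with h
  · have := (active_of_mem_edfQueue h).2.2
    omega
  · rfl

theorem edfRem_antitone (J : Instance) (K i : ℕ) : Antitone fun t => J.edfRem K t i :=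
  antitone_nat_of_succ_le fun t => by rw [J.edfRem_eq_succ_add K t i]; omega

theorem edfRem_le (J : Instance) (K t i : ℕ) : J.edfRem K t i ≤ J.p i :=
  J.edfRem_antitone K i (Nat.zero_le t)

theorem edfRem_of_le_release {t i : ℕ} (h : t ≤ J.r i) : J.edfRem K t i = J.p i := by
  induction t with
  | zero => rfl
  | succ t ih =>
    have h1 := J.edfRem_eq_succ_add K t i
    rw [ih (by omega), if_neg fun hq => by have := (active_of_mem_edfQueue hq).2.1; omega] at h1
    exact h1.symm

/-- The work on the jobs of `A` that is left at time `r` is done by time `t` or left at time `t`. -/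
theorem sum_edfRem (J : Instance) (K : ℕ) (A : Finset ℕ) {r t : ℕ} (h : r ≤ t) :
    ∑ i ∈ A, J.edfRem K r i = ∑ i ∈ A, J.edfRem K t i +
      ∑ s ∈ Finset.Ico r t, (A.filter fun i => i ∈ J.edfQueue K (J.edfRem K s) s).card := by
  induction t, h using Nat.le_induction with
  | base => simp
  | succ t h ih =>
    rw [Finset.sum_Ico_succ_top h, ih, Finset.card_filter,
      Finset.sum_congr rfl fun i _ => J.edfRem_eq_succ_add K t i, Finset.sum_add_distrib]
    ring

theorem edfRem_eq_add_card (J : Instance) (K j : ℕ) {r t : ℕ} (h : r ≤ t) :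
    J.edfRem K r j = J.edfRem K t j +
      ((Finset.Ico r t).filter fun s => j ∈ J.edfQueue K (J.edfRem K s) s).card := by
  have h1 := J.sum_edfRem K {j} h
  rw [Finset.sum_singleton, Finset.sum_singleton] at h1
  rw [h1, Finset.card_filter]
  congr 1
  refine Finset.sum_congr rfl fun s _ => ?_
  rw [Finset.filter_singleton]
  split_ifs <;> simp

/-- The unfinished work at time `t` on jobs released before `t` whose deadline is at most `d`. -/
def edfBacklog (J : Instance) (K d t : ℕ) : ℕ :=
  ∑ i ∈ J.jobs.filter fun i => J.r i < t ∧ J.d i ≤ d, J.edfRem K t i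

/-- While a job is unfinished and not processed, EDF keeps all machines busy with jobs of no later
deadline, which bounds the backlog at a later time. -/
theorem edfBacklog_add_le {d t j : ℕ} (hj : j ∈ J.jobs) (hrt : J.r j < t) (hd : J.d j ≤ d)
    (hrem : 0 < J.edfRem K t j) :
    K * (t - J.r j - J.p j) + J.edfBacklog K d t ≤
      J.edfBacklog K d (J.r j) +
        ∑ i ∈ J.jobs.filter (fun i => J.r j ≤ J.r i ∧ J.d i ≤ d), J.p i := by
  set r := J.r j
  set D := J.jobs.filter fun i => J.r i < t ∧ J.d i ≤ d with hD
  have h1 := J.sum_edfRem K D hrt.le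
  have h2 : ∑ i ∈ D, J.edfRem K r i ≤ J.edfBacklog K d r +
      ∑ i ∈ J.jobs.filter (fun i => r ≤ J.r i ∧ J.d i ≤ d), J.p i := by
    rw [← Finset.sum_filter_add_sum_filter_not D (fun i => J.r i < r)]
    refine Nat.add_le_add ?_ ?_
    · refine Finset.sum_le_sum_of_subset fun i => ?_
      simp only [hD, Finset.mem_filter]
      tauto
    · refine (Finset.sum_le_sum fun i _ => J.edfRem_le K r i).trans ?_
      refine Finset.sum_le_sum_of_subset fun i => ?_
      simp only [hD, Finset.mem_filter, not_lt]
      tauto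
  have h3 : K * ((Finset.Ico r t).filter fun s => j ∉ J.edfQueue K (J.edfRem K s) s).card ≤
      ∑ s ∈ Finset.Ico r t, (D.filter fun i => i ∈ J.edfQueue K (J.edfRem K s) s).card := by
    rw [mul_comm, ← smul_eq_mul, ← Finset.sum_const]
    refine (Finset.sum_le_sum fun s hs => ?_).trans
      (Finset.sum_le_sum_of_subset (Finset.filter_subset _ _))
    obtain ⟨hs, hq⟩ := Finset.mem_filter.1 hs
    rw [Finset.mem_Ico] at hs
    obtain ⟨hlen, hdl⟩ := edfQueue_busy hj hs.1
      (hrem.trans_le (J.edfRem_antitone K j hs.2.le)) hq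
    refine hlen.symm.le.trans ?_
    rw [← List.toFinset_card_of_nodup (J.nodup_edfQueue K _ s)]
    refine Finset.card_le_card fun i hi => ?_
    have hi := List.mem_toFinset.1 hi
    have hact := active_of_mem_edfQueue hi
    simp only [hD, Finset.mem_filter]
    exact ⟨⟨hact.1, hact.2.1.trans_lt hs.2, (hdl i hi).trans hd⟩, hi⟩
  have h4 := J.edfRem_eq_add_card K j hrt.le
  have h5 := Finset.card_filter_add_card_filter_not (s := Finset.Ico r t)
    (fun s => j ∈ J.edfQueue K (J.edfRem K s) s)
  rw [Nat.card_Ico] at h5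
  rw [edfRem_of_le_release le_rfl] at h4
  have h6 : K * (t - r - J.p j) ≤
      K * ((Finset.Ico r t).filter fun s => j ∉ J.edfQueue K (J.edfRem K s) s).card :=
    Nat.mul_le_mul_left K (by omega)
  have h7 : J.edfBacklog K d t = ∑ i ∈ D, J.edfRem K t i := rfl
  omega

/-- EDF never builds up a large backlog: if all jobs are loose and the work that has to be done
within an interval is at most `M` times its length, then the backlog with respect to `d` is at
most `2 / (1 - α) * M * (d - t)` at time `t`. -/
theorem edfBacklog_le {α M : ℝ} (hα1 : α < 1) (hM : 0 ≤ M)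
    (hloose : ∀ j ∈ J.jobs, (J.p j : ℝ) ≤ α * ((J.d j : ℝ) - J.r j)) (hα0 : 0 ≤ α)
    (hload : ∀ a b : ℕ, a < b →
      ((∑ j ∈ J.jobs.filter (fun j => a ≤ J.r j ∧ J.d j ≤ b), J.p j : ℕ) : ℝ) ≤
        M * ((b : ℝ) - a))
    (hK : (2 / (1 - α) + 1) * M * (2 / (1 - α)) ≤ K) {d t : ℕ} (htd : t ≤ d) :
    (J.edfBacklog K d t : ℝ) ≤ 2 / (1 - α) * M * ((d : ℝ) - t) := by
  have hβ : 0 < 1 - α := by linarith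
  induction t using Nat.strong_induction_on with
  | _ t ih =>
  have htd' : (0 : ℝ) ≤ (d : ℝ) - t := sub_nonneg.2 (by exact_mod_cast htd)
  have hgoal : 0 ≤ 2 / (1 - α) * M * ((d : ℝ) - t) := by positivity
  set U := (J.jobs.filter fun i => J.r i < t ∧ J.d i ≤ d).filter fun i => 0 < J.edfRem K t i
    with hU
  have hRU : J.edfBacklog K d t = ∑ i ∈ U, J.edfRem K t i := by
    exact (Finset.sum_filter_of_ne fun i _ hi => Nat.pos_of_ne_zero hi).symm
  rcases U.eq_empty_or_nonempty with hUe | hUne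
  · rw [hRU, hUe]
    simpa using hgoal
  -- The unfinished job with the earliest release date.
  obtain ⟨j, hjU, hmin⟩ := U.exists_min_image J.r hUne
  simp only [hU, Finset.mem_filter] at hjU
  obtain ⟨⟨hj, hrt, hd⟩, hrem⟩ := hjU
  have hl := hload (J.r j) d (by omega)
  have hrtR : (J.r j : ℝ) < t := by exact_mod_cast hrt
  have hdR : (J.d j : ℝ) ≤ d := by exact_mod_cast hd
  have h1 : (J.edfBacklog K d t : ℝ) ≤ M * ((d : ℝ) - J.r j) := by
    refine le_trans ?_ hl
    rw [hRU]
    norm_cast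
    refine (Finset.sum_le_sum fun i _ => J.edfRem_le K t i).trans
      (Finset.sum_le_sum_of_subset fun i hi => ?_)
    have hri := hmin i hi
    simp only [hU, Finset.mem_filter] at hi ⊢
    exact ⟨hi.1.1, hri, hi.1.2.2⟩
  have hid : 2 / (1 - α) * ((1 - α) / 2) = 1 := by field_simp
  by_cases hcase : (d : ℝ) - J.r j ≤ 2 / (1 - α) * ((d : ℝ) - t)
  · refine h1.trans ((mul_le_mul_of_nonneg_left hcase hM).trans (le_of_eq ?_))
    ring
  · -- Now `t` is late in the window, and the job has been delayed for a long time.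
    have hdt : (d : ℝ) - t < (1 - α) / 2 * ((d : ℝ) - J.r j) := by
      have := mul_lt_mul_of_pos_left (not_le.1 hcase) (show 0 < (1 - α) / 2 by linarith)
      have e : (1 - α) / 2 * (2 / (1 - α) * ((d : ℝ) - t)) = (d : ℝ) - t := by
        rw [← mul_assoc, mul_comm ((1 - α) / 2), hid, one_mul]
      linarith
    have hp : (J.p j : ℝ) ≤ α * ((d : ℝ) - J.r j) :=
      (hloose j hj).trans (mul_le_mul_of_nonneg_left (by linarith) hα0)
    have hdel : (1 - α) / 2 * ((d : ℝ) - J.r j) ≤ ((t - J.r j - J.p j : ℕ) : ℝ) := by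
      have : (t : ℝ) ≤ ((t - J.r j - J.p j : ℕ) : ℝ) + J.r j + J.p j := by
        norm_cast
        omega
      nlinarith
    have hadd : (K : ℝ) * ((t - J.r j - J.p j : ℕ) : ℝ) + J.edfBacklog K d t ≤
        J.edfBacklog K d (J.r j) +
          ((∑ i ∈ J.jobs.filter (fun i => J.r j ≤ J.r i ∧ J.d i ≤ d), J.p i : ℕ) : ℝ) := by
      exact_mod_cast edfBacklog_add_le hj hrt hd hrem
    have hih := ih (J.r j) hrt (by omega)
    have hKpos : (0 : ℝ) ≤ K := Nat.cast_nonneg K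
    have hdr : 0 ≤ (d : ℝ) - J.r j := by linarith
    have hbig : (2 / (1 - α) + 1) * M * ((d : ℝ) - J.r j) ≤
        (K : ℝ) * ((t - J.r j - J.p j : ℕ) : ℝ) := by
      calc (2 / (1 - α) + 1) * M * ((d : ℝ) - J.r j)
          = (2 / (1 - α) + 1) * M * (2 / (1 - α)) * ((1 - α) / 2 * ((d : ℝ) - J.r j)) := by
            rw [mul_assoc _ (2 / (1 - α)), ← mul_assoc (2 / (1 - α)), hid, one_mul]
        _ ≤ K * ((t - J.r j - J.p j : ℕ) : ℝ) := by gcongr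
    have : (2 / (1 - α) + 1) * M * ((d : ℝ) - J.r j) =
      2 / (1 - α) * M * ((d : ℝ) - J.r j) + M * ((d : ℝ) - J.r j) := by ring
    linarith

/-- EDF on sufficiently many machines finishes loose jobs in time. -/
theorem edfRem_deadline_eq_zero {α M : ℝ} (hα0 : 0 ≤ α) (hα1 : α < 1) (hM : 0 ≤ M)
    (hloose : ∀ j ∈ J.jobs, (J.p j : ℝ) ≤ α * ((J.d j : ℝ) - J.r j))
    (hload : ∀ a b : ℕ, a < b →
      ((∑ j ∈ J.jobs.filter (fun j => a ≤ J.r j ∧ J.d j ≤ b), J.p j : ℕ) : ℝ) ≤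
        M * ((b : ℝ) - a))
    (hK : (2 / (1 - α) + 1) * M * (2 / (1 - α)) ≤ K) {j : ℕ} (hj : j ∈ J.jobs) :
    J.edfRem K (J.d j) j = 0 := by
  by_contra h0
  have hp : 0 < J.p j := (Nat.pos_of_ne_zero h0).trans_le (J.edfRem_le K _ j)
  have hrd : J.r j < J.d j := by
    have h1 := hloose j hj
    have h2 : (0 : ℝ) < J.p j := by exact_mod_cast hp
    have h3 : (J.r j : ℝ) < J.d j := by
      by_contra h
      nlinarith
    exact_mod_cast h3
  have h1 := edfBacklog_le hα1 hM hloose hα0 hload hK (le_refl (J.d j))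
  rw [sub_self, mul_zero] at h1
  have h2 : J.edfBacklog K (J.d j) (J.d j) ≤ 0 := by exact_mod_cast h1
  have h3 : J.edfRem K (J.d j) j ≤ J.edfBacklog K (J.d j) (J.d j) :=
    Finset.single_le_sum (f := fun i => J.edfRem K (J.d j) i) (fun _ _ => Nat.zero_le _)
      (by simp [hj, hrd])
  omega

/-! ### The schedule of EDF -/

theorem mem_edfQueue_of_edfSlot {q t j : ℕ} (h : J.edfSlot K q t = some j) :
    j ∈ J.edfQueue K (J.edfRem K t) t :=
  List.mem_of_getElem? h

theorem lt_of_edfSlot {q t j : ℕ} (h : J.edfSlot K q t = some j) : q < K := by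
  obtain ⟨hq, -⟩ := List.getElem?_eq_some_iff.1 h
  exact hq.trans_le (List.length_take_le _ _)

theorem exists_edfSlot_iff {t j : ℕ} :
    (∃ q, J.edfSlot K q t = some j) ↔ j ∈ J.edfQueue K (J.edfRem K t) t :=
  List.mem_iff_getElem?.symm

theorem edfSlot_inj {q q' t j : ℕ} (h : J.edfSlot K q t = some j)
    (h' : J.edfSlot K q' t = some j) : q = q' := by
  obtain ⟨hq, -⟩ := List.getElem?_eq_some_iff.1 h
  exact (List.getElem?_inj hq (J.nodup_edfQueue K _ t)).1 (h.trans h'.symm)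

theorem lt_deadline_of_mem_edfQueue {t j : ℕ} (hfin : J.edfRem K (J.d j) j = 0)
    (h : j ∈ J.edfQueue K (J.edfRem K t) t) : t < J.d j := by
  by_contra hd
  have h1 := J.edfRem_antitone K j (not_lt.1 hd)
  have h2 := (active_of_mem_edfQueue h).2.2
  simp only at h1
  omega

/-- The slots in which EDF processes `j` are as many as its processing time. -/
theorem card_edf_slots {j : ℕ} (hfin : J.edfRem K (J.d j) j = 0) :
    ((Finset.range (J.d j)).filter fun t => j ∈ J.edfQueue K (J.edfRem K t) t).card = J.p j := by
  have h := J.edfRem_eq_add_card K j (Nat.zero_le (J.d j))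
  rw [hfin, zero_add, ← Finset.range_eq_Ico] at h
  exact h.symm

theorem feasibleOn_of_edf (hfin : ∀ j ∈ J.jobs, J.edfRem K (J.d j) j = 0) : FeasibleOn J K := by
  refine ⟨_, feasible_of_slots (slot := fun (q : Fin K) t => J.edfSlot K q t) ?_ ?_ ?_ ?_⟩
  · intro _ _ _ _
    trivial
  · intro q t j h
    have hq := mem_edfQueue_of_edfSlot h
    have hact := active_of_mem_edfQueue hq
    exact ⟨hact.1, hact.2.1, lt_deadline_of_mem_edfQueue (hfin j hact.1) hq⟩
  · intro q q' t j h h'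
    exact Fin.ext (edfSlot_inj h h')
  · intro j hj
    refine ⟨_, card_edf_slots (hfin j hj), fun t => ?_⟩
    rw [Finset.mem_filter, Finset.mem_range]
    constructor
    · rintro ⟨-, h⟩
      obtain ⟨q, hq⟩ := exists_edfSlot_iff.2 h
      exact ⟨⟨q, lt_of_edfSlot hq⟩, hq⟩
    · rintro ⟨q, hq⟩
      have h := mem_edfQueue_of_edfSlot hq
      exact ⟨lt_deadline_of_mem_edfQueue (hfin j hj) h, h⟩

end Instance


/-! ### The greedy partition of the critical jobs -/

section Greedy

variable {J : Instance} {pick : ℕ → ℕ → Finset ℕ → ℕ} {rem : ℕ → ℕ} {t : ℕ}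

/-- What holds for the sets `S` into which the greedy procedure has put the jobs of `P`: they form
a partition of `P` into nonempty sets listed in the EDF order, and each job fits with the next. -/
structure IsGreedyPartition (J : Instance) (rem : ℕ → ℕ) (t : ℕ) (P : List ℕ)
    (S : List (List ℕ)) : Prop where
  ne_nil : ∀ l ∈ S, l ≠ []
  perm : S.flatten.Perm P
  sorted : ∀ l ∈ S, l.Pairwise fun a b => J.edfKey a < J.edfKey b
  chain : ∀ l ∈ S, l.IsChain fun a b => Fits J rem t a b

theorem mem_candidates {S : List (List ℕ)} {j i : ℕ} :
    i ∈ candidates J rem t S j ↔ ∃ a l, S[i]? = some (a :: l) ∧ Fits J rem t j a := by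
  simp only [candidates, Finset.mem_filter, Finset.mem_range]
  constructor
  · rintro ⟨-, a, ha, hf⟩
    obtain ⟨l, hl, hla⟩ := Option.bind_eq_some_iff.1 ha
    obtain ⟨l', rfl⟩ := List.head?_eq_some_iff.1 hla
    exact ⟨a, l', hl, hf⟩
  · rintro ⟨a, l, hl, hf⟩
    exact ⟨(List.getElem?_eq_some_iff.1 hl).1, a, by simp [hl], hf⟩

theorem IsGreedyPartition.greedyAdd (hpick : IsChoiceRule pick) {P : List ℕ} {S : List (List ℕ)}
    {j : ℕ} (h : IsGreedyPartition J rem t P S) (hj : ∀ a ∈ P, J.edfKey j < J.edfKey a) :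
    IsGreedyPartition J rem t (P ++ [j]) (greedyAdd J pick rem t S j) := by
  rw [MachineMin.greedyAdd]
  split_ifs with hc
  · obtain ⟨a, l, hl, hf⟩ := mem_candidates.1 (hpick t j _ hc)
    generalize pick t j (candidates J rem t S j) = i at hl
    obtain ⟨hi, hia⟩ := List.getElem?_eq_some_iff.1 hl
    rw [List.modify_eq_take_cons_drop hi, hia]
    have hS : S = S.take i ++ (a :: l) :: S.drop (i + 1) := by
      rw [← hia, ← List.drop_eq_getElem_cons hi, List.take_append_drop]
    have halS : (a :: l) ∈ S := List.mem_of_getElem? hl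
    have hmem : ∀ l' ∈ S.take i ++ (j :: a :: l) :: S.drop (i + 1), l' ∈ S ∨ l' = j :: a :: l := by
      intro l' hl'
      rcases List.mem_append.1 hl' with h1 | h1
      · exact Or.inl (List.mem_of_mem_take h1)
      · rcases List.mem_cons.1 h1 with h1 | h1
        · exact Or.inr h1
        · exact Or.inl (List.mem_of_mem_drop h1)
    constructor
    · intro l' hl'
      rcases hmem l' hl' with h1 | rfl
      · exact h.ne_nil l' h1
      · simp
    · have hp := h.perm
      rw [hS] at hp
      simp only [List.flatten_append, List.flatten_cons, List.cons_append] at hp ⊢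
      refine List.perm_middle.trans ((hp.cons j).trans ?_)
      exact (List.perm_append_singleton j P).symm
    · intro l' hl'
      rcases hmem l' hl' with h1 | rfl
      · exact h.sorted l' h1
      · refine List.pairwise_cons.2 ⟨fun b hb => hj b ?_, h.sorted _ halS⟩
        exact h.perm.mem_iff.1 (List.mem_flatten.2 ⟨_, halS, hb⟩)
    · intro l' hl'
      rcases hmem l' hl' with h1 | rfl
      · exact h.chain l' h1
      · exact List.isChain_cons_cons.2 ⟨hf, h.chain _ halS⟩
  · constructor
    · intro l hl
      rcases List.mem_append.1 hl with h1 | h1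
      · exact h.ne_nil l h1
      · simp [List.mem_singleton.1 h1]
    · rw [List.flatten_append]
      simpa using h.perm.append_right [j]
    · intro l hl
      rcases List.mem_append.1 hl with h1 | h1
      · exact h.sorted l h1
      · simp [List.mem_singleton.1 h1]
    · intro l hl
      rcases List.mem_append.1 hl with h1 | h1
      · exact h.chain l h1
      · simp [List.mem_singleton.1 h1]

/-- The first jobs of the sets: one for each set, and all of them jobs of the partition. -/
theorem IsGreedyPartition.exists_heads {P : List ℕ} {S : List (List ℕ)}
    (h : IsGreedyPartition J rem t P S) (hP : P.Nodup) :
    ∃ H : Finset ℕ, H.card = S.length ∧ ∀ a ∈ H, a ∈ P ∧ ∃ (i : ℕ) (l : List ℕ),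
      S[i]? = some (a :: l) := by
  have hnd := List.nodup_flatten.1 (h.perm.nodup_iff.2 hP)
  have hhead : ∀ l ∈ S, ∃ l', l = l.headD 0 :: l' := by
    intro l hl
    cases l with
    | nil => exact absurd rfl (h.ne_nil _ hl)
    | cons a l => exact ⟨l, rfl⟩
  refine ⟨(S.map fun l => l.headD 0).toFinset, ?_, ?_⟩
  · rw [List.toFinset_card_of_nodup, List.length_map]
    rw [List.Nodup, List.pairwise_map]
    refine List.Pairwise.imp_of_mem ?_ hnd.2
    intro l₁ l₂ h₁ h₂ hd he
    obtain ⟨l₁', e₁⟩ := hhead l₁ h₁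
    obtain ⟨l₂', e₂⟩ := hhead l₂ h₂
    have m₁ : l₁.headD 0 ∈ l₁ := by
      rw [e₁]
      simp
    have m₂ : l₁.headD 0 ∈ l₂ := by
      rw [he, e₂]
      simp
    exact hd m₁ m₂
  · intro a ha
    obtain ⟨l, hl, rfl⟩ := List.mem_map.1 (List.mem_toFinset.1 ha)
    obtain ⟨l', e⟩ := hhead l hl
    obtain ⟨i, hi⟩ := List.getElem?_of_mem hl
    refine ⟨h.perm.mem_iff.1 (List.mem_flatten.2 ⟨l, hl, ?_⟩), i, l', hi.trans (by rw [← e])⟩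
    rw [e]
    simp

theorem length_greedyAdd_le {P : List ℕ} {S : List (List ℕ)} {j : ℕ} {B : ℕ}
    (h : IsGreedyPartition J rem t P S) (hP : P.Nodup) (hS : S.length ≤ B)
    (hB : ∀ H : Finset ℕ, (∀ a ∈ H, a ∈ P ∧ ¬ Fits J rem t j a) → H.card + 1 ≤ B) :
    (greedyAdd J pick rem t S j).length ≤ B := by
  rw [greedyAdd]
  split_ifs with hc
  · rwa [List.length_modify]
  · obtain ⟨H, hH, hHm⟩ := h.exists_heads hP
    rw [List.length_append, List.length_singleton, ← hH]
    refine hB H fun a ha => ?_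
    obtain ⟨haP, i, l, hi⟩ := hHm a ha
    refine ⟨haP, fun hf => hc ⟨i, mem_candidates.2 ⟨a, l, hi, hf⟩⟩⟩

theorem greedy_foldl (hpick : IsChoiceRule pick) {B : ℕ} (Q : List ℕ) :
    ∀ (P : List ℕ) (S : List (List ℕ)), IsGreedyPartition J rem t P S → S.length ≤ B →
      (P ++ Q).Pairwise (fun a b => J.edfKey b < J.edfKey a) →
      (∀ j ∈ Q, ∀ H : Finset ℕ, (∀ a ∈ H, a ∈ P ++ Q ∧ J.edfKey j < J.edfKey a ∧
        ¬ Fits J rem t j a) → H.card + 1 ≤ B) →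
      IsGreedyPartition J rem t (P ++ Q) (Q.foldl (greedyAdd J pick rem t) S) ∧
        (Q.foldl (greedyAdd J pick rem t) S).length ≤ B := by
  induction Q with
  | nil =>
    intro P S h hS _ _
    simpa using ⟨h, hS⟩
  | cons j Q ih =>
    intro P S h hS hp hB
    have hP : P.Nodup := (List.pairwise_append.1 hp).1.imp fun hlt he => by simp [he] at hlt
    have hj : ∀ a ∈ P, J.edfKey j < J.edfKey a := fun a ha =>
      (List.pairwise_append.1 hp).2.2 a ha j (by simp)
    have e : P ++ j :: Q = (P ++ [j]) ++ Q := by simp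
    rw [e] at hp hB ⊢
    refine ih (P ++ [j]) _ (h.greedyAdd hpick hj) (length_greedyAdd_le h hP hS ?_) hp
      fun i hi => hB i (List.mem_cons_of_mem _ hi)
    intro H hH
    refine hB j (by simp) H fun a ha => ⟨?_, hj a (hH a ha).1, (hH a ha).2⟩
    simp [(hH a ha).1]

/-- The greedy procedure produces a partition. It has at most `B` sets, if `B` exceeds the number
of jobs that can keep another job from being added to an existing set. -/
theorem isGreedyPartition_greedySets (hpick : IsChoiceRule pick) {B : ℕ} {T : Finset ℕ}
    (hB : ∀ j ∈ T, ∀ H ⊆ T, (∀ a ∈ H, J.d j ≤ J.d a ∧ ¬ Fits J rem t j a) → H.card + 1 ≤ B) :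
    IsGreedyPartition J rem t (J.edfSort T).reverse (greedySets J pick rem t T) ∧
      (greedySets J pick rem t T).length ≤ B := by
  refine greedy_foldl hpick (J.edfSort T).reverse [] [] ?_ (Nat.zero_le _) ?_ ?_
  · constructor <;> simp
  · rw [List.nil_append, List.pairwise_reverse]
    exact J.pairwise_edfSort T
  · intro j hj H hH
    have hmem : ∀ {i}, i ∈ (J.edfSort T).reverse → i ∈ T := fun h =>
      Instance.mem_edfSort.1 (List.mem_reverse.1 h)
    exact hB j (hmem hj) H (fun a ha => hmem (hH a ha).1)
      fun a ha => ⟨Instance.deadline_le_of_edfKey_le (hH a ha).2.1.le, (hH a ha).2.2⟩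

end Greedy

/-! ### Splitting the sets -/

theorem length_splitSet (μ : ℕ) (l : List ℕ) : (splitSet μ l).length = μ := by
  simp [splitSet]

theorem subset_of_mem_splitSet {μ : ℕ} {l : List ℕ} {A : Finset ℕ} (hA : A ∈ splitSet μ l)
    {j : ℕ} (hj : j ∈ A) : j ∈ l := by
  obtain ⟨k, -, rfl⟩ := List.mem_map.1 hA
  exact List.mem_toFinset.1 (Finset.mem_filter.1 hj).1

theorem exists_mem_splitSet {μ : ℕ} (hμ : 1 ≤ μ) {l : List ℕ} {j : ℕ} (hj : j ∈ l) :
    ∃ A ∈ splitSet μ l, j ∈ A := by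
  refine ⟨_, List.mem_map.2 ⟨(l.idxOf j + 1) % μ, List.mem_range.2 (Nat.mod_lt _ hμ), rfl⟩, ?_⟩
  simp [hj]

theorem pairwise_disjoint_splitSet (μ : ℕ) (l : List ℕ) : (splitSet μ l).Pairwise Disjoint := by
  rw [splitSet, List.pairwise_map]
  refine List.Pairwise.imp ?_ List.nodup_range
  intro a b hab
  refine Finset.disjoint_left.2 fun j h1 h2 => hab ?_
  rw [← (Finset.mem_filter.1 h1).2, ← (Finset.mem_filter.1 h2).2]

theorem idxOf_add_le_of_mem_splitSet {μ : ℕ} {l : List ℕ} {A : Finset ℕ}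
    (hA : A ∈ splitSet μ l) {b c : ℕ} (hb : b ∈ A) (hc : c ∈ A) (h : l.idxOf b < l.idxOf c) :
    l.idxOf b + μ ≤ l.idxOf c := by
  obtain ⟨k, -, rfl⟩ := List.mem_map.1 hA
  have h1 := (Finset.mem_filter.1 hb).2
  have h2 := (Finset.mem_filter.1 hc).2
  have h3 : μ ∣ (l.idxOf c + 1) - (l.idxOf b + 1) :=
    (Nat.modEq_iff_dvd' (by omega)).1 (h1.trans h2.symm)
  have := Nat.le_of_dvd (by omega) h3
  omega

theorem idxOf_lt_of_edfKey_lt {J : Instance} {l : List ℕ}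
    (hl : l.Pairwise fun a b => J.edfKey a < J.edfKey b) {b c : ℕ} (hb : b ∈ l) (hc : c ∈ l)
    (h : J.edfKey b < J.edfKey c) : l.idxOf b < l.idxOf c := by
  by_contra hlt
  rcases (not_lt.1 hlt).lt_or_eq with h1 | h1
  · have h2 := List.pairwise_iff_getElem.1 hl _ _ (List.idxOf_lt_length_iff.2 hc)
      (List.idxOf_lt_length_iff.2 hb) h1
    rw [List.getElem_idxOf, List.getElem_idxOf] at h2
    exact absurd h2 h.not_gt
  · have h2 := (List.idxOf_inj hc).1 h1
    rw [h2] at h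
    exact lt_irrefl _ h

/-- Along a chain in which each window `x b` is at most the laxity `y c` of the next job, and
laxities are at most `β` times the window, windows grow geometrically. -/
theorem chain_geometric {l : List ℕ} {x y : ℕ → ℝ} {β : ℝ} (hβ : 0 ≤ β)
    (hchain : l.IsChain fun b c => x b ≤ y c) (hy : ∀ c ∈ l, y c ≤ β * x c) {i k : ℕ}
    (hik : i < k) (hk : k < l.length) : x l[i] ≤ β ^ (k - i - 1) * y l[k] := by
  induction k, hik using Nat.le_induction with
  | base =>
    simpa using List.isChain_iff_getElem.1 hchain i hk
  | succ k hik ih =>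
    have h1 := ih (by omega)
    have h2 := hy l[k] (List.getElem_mem _)
    have h3 : x l[k] ≤ y l[k + 1] := List.isChain_iff_getElem.1 hchain k hk
    have e : k + 1 - i - 1 = (k - i - 1) + 1 := by omega
    calc x l[i] ≤ β ^ (k - i - 1) * y l[k] := h1
      _ ≤ β ^ (k - i - 1) * (β * y l[k + 1]) := by gcongr; exact h2.trans (by gcongr)
      _ = β ^ (k + 1 - i - 1) * y l[k + 1] := by rw [e, pow_succ]; ring

/-- The effect of splitting: of two jobs in the same subset, the window of the earlier one is
a tiny fraction of the laxity of the later one. -/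
theorem window_le_of_mem_splitSet {J : Instance} {μ : ℕ} {l : List ℕ} {x y : ℕ → ℝ} {β : ℝ}
    (hβ : 0 ≤ β) (hβ1 : β ≤ 1) (hl : l.Pairwise fun a b => J.edfKey a < J.edfKey b)
    (hchain : l.IsChain fun b c => x b ≤ y c) (hy : ∀ c ∈ l, y c ≤ β * x c)
    (hy0 : ∀ c ∈ l, 0 ≤ y c) {A : Finset ℕ} (hA : A ∈ splitSet μ l) {b c : ℕ}
    (hb : b ∈ A) (hc : c ∈ A) (h : J.edfKey b < J.edfKey c) : x b ≤ β ^ (μ - 1) * y c := by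
  have hbl := subset_of_mem_splitSet hA hb
  have hcl := subset_of_mem_splitSet hA hc
  have h1 := idxOf_lt_of_edfKey_lt hl hbl hcl h
  have h2 := idxOf_add_le_of_mem_splitSet hA hb hc h1
  have h3 := chain_geometric hβ hchain hy h1 (List.idxOf_lt_length_iff.2 hcl)
  rw [List.getElem_idxOf, List.getElem_idxOf] at h3
  refine h3.trans (mul_le_mul_of_nonneg_right ?_ (hy0 c hcl))
  exact pow_le_pow_of_le_one hβ hβ1 (by omega)

/-- `parts` is a partition of `T` into sets, each of which is given as a list of disjoint
subsets. -/
structure IsPartition (T : Finset ℕ) (parts : List (List (Finset ℕ))) : Prop where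
  cover : ∀ j ∈ T, ∃ A ∈ parts.flatten, j ∈ A
  subset : ∀ A ∈ parts.flatten, A ⊆ T
  disjoint : parts.flatten.Pairwise Disjoint

theorem flatten_map_map_sdiff (parts : List (List (Finset ℕ))) (s : Finset ℕ) :
    (parts.map fun Si => Si.map fun A => A \ s).flatten = parts.flatten.map fun A => A \ s := by
  rw [List.map_flatten]

theorem IsPartition.sdiff {T : Finset ℕ} {parts : List (List (Finset ℕ))}
    (h : IsPartition T parts) (s : Finset ℕ) :
    IsPartition (T \ s) (parts.map fun Si => Si.map fun A => A \ s) := by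
  constructor <;> rw [flatten_map_map_sdiff]
  · intro j hj
    rw [Finset.mem_sdiff] at hj
    obtain ⟨A, hA, hjA⟩ := h.cover j hj.1
    exact ⟨A \ s, List.mem_map.2 ⟨A, hA, rfl⟩, Finset.mem_sdiff.2 ⟨hjA, hj.2⟩⟩
  · intro A hA
    obtain ⟨A', hA', rfl⟩ := List.mem_map.1 hA
    exact Finset.sdiff_subset_sdiff (h.subset A' hA') (Finset.Subset.refl _)
  · rw [List.pairwise_map]
    exact h.disjoint.imp fun hd => hd.mono Finset.sdiff_subset Finset.sdiff_subset

theorem IsGreedyPartition.isPartition {J : Instance} {rem : ℕ → ℕ} {t : ℕ} {T : Finset ℕ}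
    {S : List (List ℕ)} (h : IsGreedyPartition J rem t (J.edfSort T).reverse S) {μ : ℕ}
    (hμ : 1 ≤ μ) : IsPartition T (S.map (splitSet μ)) := by
  have hmem : ∀ {j}, j ∈ S.flatten ↔ j ∈ T := by
    intro j
    rw [h.perm.mem_iff, List.mem_reverse, Instance.mem_edfSort]
  have hnd : S.flatten.Nodup := h.perm.nodup_iff.2 (List.nodup_reverse.2 (J.nodup_edfSort T))
  constructor
  · intro j hj
    obtain ⟨l, hl, hjl⟩ := List.mem_flatten.1 (hmem.2 hj)
    obtain ⟨A, hA, hjA⟩ := exists_mem_splitSet hμ hjl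
    exact ⟨A, List.mem_flatten.2 ⟨_, List.mem_map.2 ⟨l, hl, rfl⟩, hA⟩, hjA⟩
  · intro A hA j hj
    obtain ⟨B, hB, hAB⟩ := List.mem_flatten.1 hA
    obtain ⟨l, hl, rfl⟩ := List.mem_map.1 hB
    exact hmem.1 (List.mem_flatten.2 ⟨l, hl, subset_of_mem_splitSet hAB hj⟩)
  · rw [List.pairwise_flatten]
    constructor
    · intro B hB
      obtain ⟨l, hl, rfl⟩ := List.mem_map.1 hB
      exact pairwise_disjoint_splitSet μ l
    · rw [List.pairwise_map]
      refine (List.nodup_flatten.1 hnd).2.imp ?_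
      intro l₁ l₂ hd A₁ h₁ A₂ h₂
      refine Finset.disjoint_left.2 fun j hj₁ hj₂ => ?_
      exact hd (subset_of_mem_splitSet h₁ hj₁) (subset_of_mem_splitSet h₂ hj₂)


/-! ### Laxities of critical jobs -/

theorem mem_jobs_upTo {J : Instance} {t j : ℕ} : j ∈ (J.upTo t).jobs ↔ j ∈ J.jobs ∧ J.r j ≤ t := by
  simp [Instance.upTo]

/-- The laxity of `j` at time `t`, if its remaining processing time is `rem j`. -/
def laxity (J : Instance) (rem : ℕ → ℕ) (t j : ℕ) : ℝ := (J.d j : ℝ) - t - rem j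

/-- The laxity of `j` at its release. -/
def laxity₀ (J : Instance) (j : ℕ) : ℝ := (J.d j : ℝ) - J.r j - J.p j

theorem Admissible.laxity₀_nonneg {J : Instance} (h : Admissible J) {j : ℕ} (hj : j ∈ J.jobs) :
    0 ≤ laxity₀ J j := by
  have h1 : (J.r j : ℝ) + J.p j ≤ J.d j := by exact_mod_cast h.release_add_le_deadline hj
  rw [laxity₀]
  linarith

/-- The fraction of its initial laxity that a critical job is guaranteed to have at a release date
up to which `N` jobs have been released. It decreases from `1` to `1 / 2`. -/
noncomputable def laxFraction (N : ℕ) : ℝ := ((N : ℝ) + 1) / (2 * N)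

theorem laxFraction_le_one {N : ℕ} (hN : 1 ≤ N) : laxFraction N ≤ 1 := by
  have : (1 : ℝ) ≤ N := by exact_mod_cast hN
  rw [laxFraction, div_le_one (by positivity)]
  linarith

theorem half_le_laxFraction {N : ℕ} (hN : 1 ≤ N) : 1 / 2 ≤ laxFraction N := by
  have : (1 : ℝ) ≤ N := by exact_mod_cast hN
  rw [laxFraction, div_le_div_iff₀ (by norm_num) (by positivity)]
  linarith

theorem laxFraction_anti {N N' : ℕ} (hN : 1 ≤ N) (h : N ≤ N') :
    laxFraction N' ≤ laxFraction N := by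
  have h1 : (1 : ℝ) ≤ N := by exact_mod_cast hN
  have h2 : (N : ℝ) ≤ N' := by exact_mod_cast h
  have h3 : (0 : ℝ) < N' := by linarith
  rw [laxFraction, laxFraction, div_le_div_iff₀ (by positivity) (by positivity)]
  nlinarith

theorem mul_laxFraction {N : ℕ} (hN : 1 ≤ N) :
    (1 - 1 / ((N : ℝ) + 1) ^ 2) * laxFraction N = laxFraction (N + 1) := by
  have h1 : (1 : ℝ) ≤ N := by exact_mod_cast hN
  rw [laxFraction, laxFraction]
  push_cast
  field_simp
  ring

/-- Jobs to which `j` cannot be added all have to be processed for a long time close to `t`, so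
that there are only few of them. -/
theorem card_le_of_not_fits {J : Instance} {α : ℝ} (hα0 : 0 < α) (hα1 : α < 1)
    (hJ : Admissible J) {rem : ℕ → ℕ} {t j : ℕ} {H : Finset ℕ} (hH : H ⊆ (J.upTo t).jobs)
    (hrem : ∀ a ∈ H, rem a ≤ J.p a) (hcrit : ∀ a ∈ H, α * ((J.d a : ℝ) - t) < rem a)
    (hlax : ∀ a ∈ H, 1 / 2 * laxity₀ J a ≤ laxity J rem t a) (hj : t < J.d j)
    (hfit : ∀ a ∈ H, J.d j ≤ J.d a ∧ ¬ Fits J rem t j a) :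
    (H.card : ℝ) ≤ 6 * opt J / α := by
  obtain ⟨D, hD⟩ : ∃ D, J.d j = t + D := ⟨_, (Nat.add_sub_cancel' hj.le).symm⟩
  -- The window of `a` reaches beyond `t + D`, and its initial laxity is less than `2 * D`: either
  -- the whole job lies within distance `3 * D` of `t`, or at least `D` units of it do.
  have hsum := hJ.feasibleOn_opt.sum_forced_le (u := t - 3 * D) (v := t + 3 * D) (S := H)
    (fun a ha => (mem_jobs_upTo.1 (hH ha)).1) (fun a => min (rem a) D) (by
      intro a ha
      obtain ⟨haJ, har⟩ := mem_jobs_upTo.1 (hH ha)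
      have h1 := hJ.release_add_le_deadline haJ
      have h2 := hrem a ha
      obtain ⟨h3, h4⟩ := hfit a ha
      have h5 := hlax a ha
      rw [laxity₀, laxity] at h5
      have h6 : (J.d a : ℝ) - J.r a - J.p a ≤ 2 * (J.d a - t - rem a) := by linarith
      have h7 : (J.d a : ℤ) - J.r a - J.p a ≤ 2 * (J.d a - t - rem a) := by exact_mod_cast h6
      rw [Fits, not_le] at h4
      omega)
  have hDpos : (0 : ℝ) < D := by
    have : 0 < D := by omega
    exact_mod_cast this
  have hlow : (H.card : ℝ) * (α * D) ≤ ((∑ a ∈ H, min (rem a) D : ℕ) : ℝ) := by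
    rw [← nsmul_eq_mul, ← Finset.sum_const]
    push_cast
    refine Finset.sum_le_sum fun a ha => le_min ?_ (by nlinarith)
    refine le_trans ?_ (hcrit a ha).le
    have : (J.d j : ℝ) ≤ J.d a := by exact_mod_cast (hfit a ha).1
    rw [hD] at this
    push_cast at this
    gcongr
    linarith
  have hup : ((∑ a ∈ H, min (rem a) D : ℕ) : ℝ) ≤ opt J * (6 * D) := by
    have : t + 3 * D - (t - 3 * D) ≤ 6 * D := by omega
    exact_mod_cast hsum.trans (Nat.mul_le_mul_left _ this)
  rw [le_div_iff₀ hα0]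
  have := hlow.trans hup
  nlinarith

/-! ### The invariant of the critical jobs -/

/-- The invariant of the states of the algorithm. In the field `history`, `τ` stands for the last
release date (or is irrelevant, if there has been none) and `x c` for the laxity of `c` at time `τ`.
Since then, the laxity of a critical job has decreased by at most the elapsed time and by at most
a fraction `(1 - α) ^ (μ - 1)`. -/
structure CritInv (J : Instance) (α : ℝ) (μ : ℕ → ℕ) (t : ℕ) (s : CritState) : Prop where
  safe_subset : s.safe ⊆ (J.upTo t).jobs
  rem_le : ∀ j, s.rem j ≤ J.p j
  rem_new : ∀ j, t < J.r j → s.rem j = J.p j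
  critical : ∀ c ∈ (J.upTo t).jobs \ s.safe, α * ((J.d c : ℝ) - t) < s.rem c
  partition : IsPartition ((J.upTo t).jobs \ s.safe) s.parts
  length_parts : (s.parts.length : ℝ) ≤ 6 * opt J / α + 1
  length_sets : ∀ l ∈ s.parts, l.length = μ (J.upTo t).jobs.card
  history : ∃ τ ≤ t, ∃ x : ℕ → ℝ,
    (∀ A ∈ s.parts.flatten, ∀ b ∈ A, ∀ c ∈ A, J.edfKey b < J.edfKey c →
      (J.d b : ℝ) - τ ≤ (1 - α) ^ (μ (J.upTo t).jobs.card - 1) * x c) ∧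
    ∀ c ∈ (J.upTo t).jobs \ s.safe,
      laxFraction (J.upTo t).jobs.card * laxity₀ J c ≤ x c ∧
      x c - ((t : ℝ) - τ) ≤ laxity J s.rem t c ∧
      (1 - (1 - α) ^ (μ (J.upTo t).jobs.card - 1)) * x c ≤ laxity J s.rem t c

/-- The numbers `μ N` of subsets are large enough for the delays to be negligible. -/
def SplitsEnough (α : ℝ) (μ : ℕ → ℕ) : Prop :=
  ∀ N, 1 ≤ μ N ∧ (1 - α) ^ (μ N - 1) ≤ 1 / ((N : ℝ) + 1) ^ 2

section Invariant

variable {J : Instance} {α : ℝ} {μ : ℕ → ℕ} {pick : ℕ → ℕ → Finset ℕ → ℕ} {t : ℕ} {s : CritState}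

theorem one_le_card_upTo {j : ℕ} (hj : j ∈ (J.upTo t).jobs) : 1 ≤ (J.upTo t).jobs.card :=
  Finset.card_pos.2 ⟨j, hj⟩

theorem laxFraction_succ_mul_le (hμ : SplitsEnough α μ) {N : ℕ} (hN : 1 ≤ N) {x y : ℝ}
    (hx : 0 ≤ x) (hxy : laxFraction N * x ≤ y) :
    laxFraction (N + 1) * x ≤ (1 - (1 - α) ^ (μ N - 1)) * y := by
  have h1 := (hμ N).2
  have h2 : 0 ≤ y := le_trans (mul_nonneg (by linarith [half_le_laxFraction hN]) hx) hxy
  have h3 : 1 / ((N : ℝ) + 1) ^ 2 ≤ 1 := by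
    rw [div_le_one (by positivity)]
    nlinarith [(Nat.cast_nonneg N : (0 : ℝ) ≤ N)]
  calc laxFraction (N + 1) * x = (1 - 1 / ((N : ℝ) + 1) ^ 2) * (laxFraction N * x) := by
        rw [← mul_laxFraction hN, mul_assoc]
    _ ≤ (1 - 1 / ((N : ℝ) + 1) ^ 2) * y := by
        apply mul_le_mul_of_nonneg_left hxy
        linarith
    _ ≤ (1 - (1 - α) ^ (μ N - 1)) * y := by gcongr

theorem CritInv.laxity_ge (h : CritInv J α μ t s) (hμ : SplitsEnough α μ) (hJ : Admissible J)
    {c : ℕ} (hc : c ∈ (J.upTo t).jobs \ s.safe) :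
    laxFraction ((J.upTo t).jobs.card + 1) * laxity₀ J c ≤ laxity J s.rem t c := by
  obtain ⟨τ, -, x, -, hx⟩ := h.history
  obtain ⟨h1, -, h2⟩ := hx c hc
  have hcr := (Finset.mem_sdiff.1 hc).1
  exact (laxFraction_succ_mul_le hμ (one_le_card_upTo hcr)
    (hJ.laxity₀_nonneg (mem_jobs_upTo.1 hcr).1) h1).trans h2

theorem half_laxity_le {N : ℕ} (hN : 1 ≤ N) (hJ : Admissible J) {c : ℕ} (hc : c ∈ J.jobs) {y : ℝ}
    (h : laxFraction N * laxity₀ J c ≤ y) : 1 / 2 * laxity₀ J c ≤ y :=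
  (mul_le_mul_of_nonneg_right (half_le_laxFraction hN) (hJ.laxity₀_nonneg hc)).trans h

/-- A critical job with nonnegative laxity can still be finished and is not finished yet. -/
theorem lt_deadline_of_critical {rem : ℕ → ℕ} (hα0 : 0 < α) {c : ℕ}
    (hcrit : α * ((J.d c : ℝ) - t) < rem c) (hlax : 0 ≤ laxity J rem t c) :
    t < J.d c ∧ 0 < rem c := by
  rw [laxity] at hlax
  have h1 : (0 : ℝ) < (J.d c : ℝ) - t := by
    by_contra h
    nlinarith
  have h2 : (0 : ℝ) < rem c := lt_of_le_of_lt (by positivity) hcrit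
  exact ⟨by exact_mod_cast sub_pos.1 h1, by exact_mod_cast h2⟩

theorem CritInv.half_laxity₀_le (h : CritInv J α μ t s) (hμ : SplitsEnough α μ)
    (hJ : Admissible J) {c : ℕ} (hc : c ∈ (J.upTo t).jobs \ s.safe) :
    1 / 2 * laxity₀ J c ≤ laxity J s.rem t c :=
  half_laxity_le (by omega) hJ (mem_jobs_upTo.1 (Finset.mem_sdiff.1 hc).1).1
    (h.laxity_ge hμ hJ hc)

theorem CritInv.lt_deadline (h : CritInv J α μ t s) (hα0 : 0 < α)
    (hμ : SplitsEnough α μ) (hJ : Admissible J) {c : ℕ} (hc : c ∈ (J.upTo t).jobs \ s.safe) :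
    t < J.d c ∧ 0 < s.rem c := by
  refine lt_deadline_of_critical hα0 (h.critical c hc) (le_trans ?_ (h.half_laxity₀_le hμ hJ hc))
  have := hJ.laxity₀_nonneg (mem_jobs_upTo.1 (Finset.mem_sdiff.1 hc).1).1
  positivity

theorem CritState.mem_running {j : ℕ} :
    some j ∈ s.running J ↔ ∃ A ∈ s.parts.flatten, (J.edfSort A).head? = some j := by
  simp only [CritState.running, List.mem_map]

theorem CritInv.critical_of_running (h : CritInv J α μ t s) {j : ℕ}
    (hj : some j ∈ s.running J) : j ∈ (J.upTo t).jobs \ s.safe := by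
  obtain ⟨A, hA, hAj⟩ := CritState.mem_running.1 hj
  exact h.partition.subset A hA (Instance.mem_of_head?_edfSort hAj)

/-- The remaining processing times after the slot that starts in state `s`. -/
def CritState.nextRem (J : Instance) (s : CritState) (j : ℕ) : ℕ :=
  if some j ∈ s.running J then s.rem j - 1 else s.rem j

theorem critState_succ (J : Instance) (α : ℝ) (μ : ℕ → ℕ) (pick : ℕ → ℕ → Finset ℕ → ℕ) (t : ℕ) :
    critState J α μ pick (t + 1) = critDecide J α μ pick (t + 1)
      ((critState J α μ pick t).nextRem J) (critState J α μ pick t).safe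
      (critState J α μ pick t).parts := rfl

/-- One slot of processing: the laxity of a critical job decreases by at most one, and it decreases
only as long as there is a job before it in its subset, which is not past its deadline. -/
theorem CritInv.laxity_nextRem (h : CritInv J α μ t s) (hα0 : 0 < α)
    (hμ : SplitsEnough α μ) (hJ : Admissible J) {τ : ℕ} {x : ℕ → ℝ}
    (hA : ∀ A ∈ s.parts.flatten, ∀ b ∈ A, ∀ c ∈ A, J.edfKey b < J.edfKey c →
      (J.d b : ℝ) - τ ≤ (1 - α) ^ (μ (J.upTo t).jobs.card - 1) * x c)
    {c : ℕ} (hc : c ∈ (J.upTo t).jobs \ s.safe)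
    (h1 : x c - ((t : ℝ) - τ) ≤ laxity J s.rem t c)
    (h2 : (1 - (1 - α) ^ (μ (J.upTo t).jobs.card - 1)) * x c ≤ laxity J s.rem t c) :
    x c - (((t + 1 : ℕ) : ℝ) - τ) ≤ laxity J (s.nextRem J) (t + 1) c ∧
      (1 - (1 - α) ^ (μ (J.upTo t).jobs.card - 1)) * x c ≤
        laxity J (s.nextRem J) (t + 1) c := by
  by_cases hrun : some c ∈ s.running J
  · have hpos := (h.lt_deadline hα0 hμ hJ hc).2
    have e : laxity J (s.nextRem J) (t + 1) c = laxity J s.rem t c := by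
      rw [laxity, laxity, CritState.nextRem, if_pos hrun, Nat.cast_sub hpos]
      push_cast
      ring
    rw [e]
    refine ⟨?_, h2⟩
    push_cast
    linarith
  · have e : laxity J (s.nextRem J) (t + 1) c = laxity J s.rem t c - 1 := by
      rw [laxity, laxity, CritState.nextRem, if_neg hrun]
      push_cast
      ring
    have h3 : x c - (((t + 1 : ℕ) : ℝ) - τ) ≤ laxity J (s.nextRem J) (t + 1) c := by
      rw [e]
      push_cast
      linarith
    refine ⟨h3, le_trans ?_ h3⟩
    obtain ⟨A, hAm, hcA⟩ := h.partition.cover c hc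
    obtain ⟨b, hb, hbc⟩ := Instance.exists_head?_edfSort (J := J) hcA fun hh =>
      hrun (CritState.mem_running.2 ⟨A, hAm, hh⟩)
    have hbA := Instance.mem_of_head?_edfSort hb
    have h4 := hA A hAm b hbA c hcA hbc
    have h5 : t + 1 ≤ J.d b := (h.lt_deadline hα0 hμ hJ (h.partition.subset A hAm hbA)).1
    have h6 : ((t + 1 : ℕ) : ℝ) ≤ J.d b := by exact_mod_cast h5
    linarith

theorem safe_critDecide_subset {rem : ℕ → ℕ} {safe : Finset ℕ} {parts : List (List (Finset ℕ))}
    (h : safe ⊆ (J.upTo t).jobs) :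
    (critDecide J α μ pick t rem safe parts).safe ⊆ (J.upTo t).jobs :=
  Finset.union_subset h (Finset.filter_subset _ _)

theorem subset_safe_critDecide {rem : ℕ → ℕ} {safe : Finset ℕ} {parts : List (List (Finset ℕ))} :
    safe ⊆ (critDecide J α μ pick t rem safe parts).safe :=
  Finset.subset_union_left

theorem critical_critDecide {rem : ℕ → ℕ} {safe : Finset ℕ} {parts : List (List (Finset ℕ))} {c : ℕ}
    (hc : c ∈ (J.upTo t).jobs \ (critDecide J α μ pick t rem safe parts).safe) :
    α * ((J.d c : ℝ) - t) < rem c := by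
  by_contra hle
  obtain ⟨h1, h2⟩ := Finset.mem_sdiff.1 hc
  exact h2 (Finset.mem_union_right _ (Finset.mem_filter.2 ⟨h1, not_lt.1 hle⟩))

/-- The invariant at a release date, if the critical jobs have kept enough of their laxity. -/
theorem critInv_of_release (hα0 : 0 < α) (hα1 : α < 1) (hμ : SplitsEnough α μ)
    (hpick : IsChoiceRule pick) (hJ : Admissible J) {rem : ℕ → ℕ} {safe : Finset ℕ}
    {parts : List (List (Finset ℕ))} (hrel : ∃ j ∈ J.jobs, J.r j = t)
    (hsafe : safe ⊆ (J.upTo t).jobs) (hle : ∀ j, rem j ≤ J.p j)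
    (hnew : ∀ j, t < J.r j → rem j = J.p j)
    (hlax : ∀ c ∈ (J.upTo t).jobs \ safe,
      laxFraction (J.upTo t).jobs.card * laxity₀ J c ≤ laxity J rem t c) :
    CritInv J α μ t (critDecide J α μ pick t rem safe parts) := by
  set s := critDecide J α μ pick t rem safe parts with hs
  set N := (J.upTo t).jobs.card with hN
  have hN1 : 1 ≤ N := by
    obtain ⟨j, hj, hr⟩ := hrel
    exact one_le_card_upTo (mem_jobs_upTo.2 ⟨hj, hr.le⟩)
  have hcrit : ∀ c ∈ (J.upTo t).jobs \ s.safe, α * ((J.d c : ℝ) - t) < rem c :=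
    fun c hc => critical_critDecide hc
  have hlax' : ∀ c ∈ (J.upTo t).jobs \ s.safe,
      laxFraction N * laxity₀ J c ≤ laxity J rem t c := fun c hc =>
    hlax c (Finset.sdiff_subset_sdiff (Finset.Subset.refl _) subset_safe_critDecide hc)
  have hmem : ∀ {c}, c ∈ (J.upTo t).jobs \ s.safe → c ∈ J.jobs := fun hc =>
    (mem_jobs_upTo.1 (Finset.mem_sdiff.1 hc).1).1
  have hhalf : ∀ c ∈ (J.upTo t).jobs \ s.safe, 1 / 2 * laxity₀ J c ≤ laxity J rem t c :=
    fun c hc => half_laxity_le hN1 hJ (hmem hc) (hlax' c hc)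
  have hlax0 : ∀ c ∈ (J.upTo t).jobs \ s.safe, 0 ≤ laxity J rem t c := fun c hc => by
    have := hJ.laxity₀_nonneg (hmem hc)
    exact le_trans (by positivity) (hhalf c hc)
  have hparts : s.parts =
      (greedySets J pick rem t ((J.upTo t).jobs \ s.safe)).map (splitSet (μ N)) := by
    rw [hs, critDecide, if_pos hrel]
  obtain ⟨hg, hlen⟩ := isGreedyPartition_greedySets (J := J) (rem := rem) (t := t) hpick
    (B := ⌊6 * opt J / α⌋₊ + 1) (T := (J.upTo t).jobs \ s.safe) (by
      intro j hj H hH hfit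
      have := card_le_of_not_fits hα0 hα1 hJ (fun a ha => (Finset.mem_sdiff.1 (hH ha)).1)
        (fun a _ => hle a) (fun a ha => hcrit a (hH ha)) (fun a ha => hhalf a (hH ha))
        (lt_deadline_of_critical hα0 (hcrit j hj) (hlax0 j hj)).1 hfit
      exact Nat.succ_le_succ (Nat.le_floor this))
  have hgmem : ∀ {l}, l ∈ greedySets J pick rem t ((J.upTo t).jobs \ s.safe) →
      ∀ c ∈ l, c ∈ (J.upTo t).jobs \ s.safe := by
    intro l hl c hc
    have := hg.perm.mem_iff.1 (List.mem_flatten.2 ⟨l, hl, hc⟩)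
    exact Instance.mem_edfSort.1 (List.mem_reverse.1 this)
  refine ⟨safe_critDecide_subset hsafe, hle, hnew, hcrit, ?_, ?_, ?_, ?_⟩
  · rw [hparts]
    exact hg.isPartition (hμ N).1
  · rw [hparts, List.length_map]
    refine le_trans (b := ((⌊6 * opt J / α⌋₊ + 1 : ℕ) : ℝ)) (by exact_mod_cast hlen) ?_
    push_cast
    gcongr
    exact Nat.floor_le (by positivity)
  · rw [hparts]
    intro B hB
    obtain ⟨l, -, rfl⟩ := List.mem_map.1 hB
    exact length_splitSet _ _
  · refine ⟨t, le_rfl, laxity J rem t, ?_, fun c hc => ⟨hlax' c hc, ?_, ?_⟩⟩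
    · rw [hparts]
      intro A hA b hb c hc hbc
      obtain ⟨B, hB, hAB⟩ := List.mem_flatten.1 hA
      obtain ⟨l, hl, rfl⟩ := List.mem_map.1 hB
      refine window_le_of_mem_splitSet (x := fun b => (J.d b : ℝ) - t) (by linarith) (by linarith)
        (hg.sorted l hl) ((hg.chain l hl).imp ?_) ?_ ?_ hAB hb hc hbc
      · intro b c hf
        rw [Fits] at hf
        rw [laxity]
        exact_mod_cast hf
      · intro c hc
        have := hcrit c (hgmem hl c hc)
        rw [laxity]
        linarith
      · exact fun c hc => hlax0 c (hgmem hl c hc)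
    · simp [hs, critDecide]
    · have h1 := hlax0 c hc
      have h2 : 0 ≤ (1 - α) ^ (μ N - 1) := pow_nonneg (by linarith) _
      change _ ≤ laxity J rem t c
      nlinarith

theorem nextRem_le (s : CritState) (j : ℕ) : s.nextRem J j ≤ s.rem j := by
  rw [CritState.nextRem]
  split_ifs <;> omega

theorem CritInv.nextRem_new (h : CritInv J α μ t s) {j : ℕ} (hj : t < J.r j) :
    s.nextRem J j = J.p j := by
  rw [CritState.nextRem, if_neg, h.rem_new j hj]
  intro hrun
  have := (mem_jobs_upTo.1 (Finset.mem_sdiff.1 (h.critical_of_running hrun)).1).2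
  omega

theorem upTo_succ_of_not_release (hrel : ¬ ∃ j ∈ J.jobs, J.r j = t + 1) :
    (J.upTo (t + 1)).jobs = (J.upTo t).jobs := by
  ext j
  rw [mem_jobs_upTo, mem_jobs_upTo]
  refine and_congr_right fun hj => ?_
  have : J.r j ≠ t + 1 := fun h => hrel ⟨j, hj, h⟩
  omega

theorem CritInv.succ (h : CritInv J α μ t s) (hα0 : 0 < α) (hα1 : α < 1) (hμ : SplitsEnough α μ)
    (hpick : IsChoiceRule pick) (hJ : Admissible J) :
    CritInv J α μ (t + 1) (critDecide J α μ pick (t + 1) (s.nextRem J) s.safe s.parts) := by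
  have hle : ∀ j, s.nextRem J j ≤ J.p j := fun j => (nextRem_le s j).trans (h.rem_le j)
  have hnew : ∀ j, t + 1 < J.r j → s.nextRem J j = J.p j := fun j hj => h.nextRem_new (by omega)
  have hmono : (J.upTo t).jobs ⊆ (J.upTo (t + 1)).jobs := fun j hj => by
    rw [mem_jobs_upTo] at hj ⊢
    exact ⟨hj.1, by omega⟩
  obtain ⟨τ, hτ, x, hA, hx⟩ := h.history
  by_cases hrel : ∃ j ∈ J.jobs, J.r j = t + 1
  · refine critInv_of_release hα0 hα1 hμ hpick hJ hrel (h.safe_subset.trans hmono) hle hnew ?_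
    intro c hc
    obtain ⟨hc1, hc2⟩ := Finset.mem_sdiff.1 hc
    have hcJ := (mem_jobs_upTo.1 hc1).1
    have hl0 := hJ.laxity₀_nonneg hcJ
    by_cases hct : c ∈ (J.upTo t).jobs
    · have hcT := Finset.mem_sdiff.2 ⟨hct, hc2⟩
      obtain ⟨h1, h2, h3⟩ := hx c hcT
      have hN := one_le_card_upTo hct
      refine le_trans ?_ (h.laxity_nextRem hα0 hμ hJ hA hcT h2 h3).2
      refine le_trans ?_ (laxFraction_succ_mul_le hμ hN hl0 h1)
      refine mul_le_mul_of_nonneg_right (laxFraction_anti (by omega) ?_) hl0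
      refine Finset.card_lt_card (Finset.ssubset_iff_subset_ne.2 ⟨hmono, fun he => ?_⟩)
      obtain ⟨j, hj, hjr⟩ := hrel
      have hjm : j ∈ (J.upTo (t + 1)).jobs := mem_jobs_upTo.2 ⟨hj, hjr.le⟩
      rw [← he, mem_jobs_upTo] at hjm
      omega
    · have hr : J.r c = t + 1 := by
        rw [mem_jobs_upTo] at hct hc1
        have : ¬ J.r c ≤ t := fun hh => hct ⟨hcJ, hh⟩
        omega
      have e : laxity J (s.nextRem J) (t + 1) c = laxity₀ J c := by
        rw [laxity, laxity₀, h.nextRem_new (by omega), hr]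
      rw [e]
      exact mul_le_of_le_one_left hl0 (laxFraction_le_one (one_le_card_upTo hc1))
  · have heq := upTo_succ_of_not_release hrel
    set s' := critDecide J α μ pick (t + 1) (s.nextRem J) s.safe s.parts with hs'
    have hparts : s'.parts = s.parts.map fun Si => Si.map fun A => A \ s'.safe := by
      rw [hs', critDecide, if_neg hrel]
    have hsub : s.safe ⊆ s'.safe := subset_safe_critDecide
    have hT : ∀ {c}, c ∈ (J.upTo t).jobs \ s'.safe → c ∈ (J.upTo t).jobs \ s.safe := fun hc =>
      Finset.sdiff_subset_sdiff (Finset.Subset.refl _) hsub hc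
    refine ⟨safe_critDecide_subset (h.safe_subset.trans hmono), hle, hnew,
      fun c hc => critical_critDecide hc, ?_, ?_, ?_, τ, by omega, x, ?_, ?_⟩
    · have e : (J.upTo t).jobs \ s'.safe = ((J.upTo t).jobs \ s.safe) \ s'.safe := by
        rw [sdiff_sdiff, sup_of_le_right hsub]
      rw [heq, hparts, e]
      exact h.partition.sdiff s'.safe
    · rw [hparts, List.length_map]
      exact h.length_parts
    · rw [hparts, heq]
      intro B hB
      obtain ⟨l, hl, rfl⟩ := List.mem_map.1 hB
      rw [List.length_map]
      exact h.length_sets l hl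
    · rw [hparts, heq, flatten_map_map_sdiff]
      intro A' hA' b hb c hc
      obtain ⟨A, hAm, rfl⟩ := List.mem_map.1 hA'
      exact hA A hAm b (Finset.mem_sdiff.1 hb).1 c (Finset.mem_sdiff.1 hc).1
    · rw [heq]
      intro c hc
      obtain ⟨h1, h2, h3⟩ := hx c (hT hc)
      exact ⟨h1, h.laxity_nextRem hα0 hμ hJ hA (hT hc) h2 h3⟩

theorem critInv_critState (hα0 : 0 < α) (hα1 : α < 1) (hμ : SplitsEnough α μ)
    (hpick : IsChoiceRule pick) (hJ : Admissible J) (t : ℕ) :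
    CritInv J α μ t (critState J α μ pick t) := by
  induction t with
  | zero =>
    rw [critState]
    have hr : ∀ {c}, c ∈ (J.upTo 0).jobs → c ∈ J.jobs ∧ J.r c = 0 := fun hc => by
      rw [mem_jobs_upTo] at hc
      exact ⟨hc.1, by omega⟩
    by_cases hrel : ∃ j ∈ J.jobs, J.r j = 0
    · refine critInv_of_release hα0 hα1 hμ hpick hJ hrel (Finset.empty_subset _)
        (fun _ => le_rfl) (fun _ _ => rfl) ?_
      intro c hc
      obtain ⟨hc1, -⟩ := Finset.mem_sdiff.1 hc
      have e : laxity J J.p 0 c = laxity₀ J c := by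
        rw [laxity, laxity₀, (hr hc1).2]
      rw [e]
      exact mul_le_of_le_one_left (hJ.laxity₀_nonneg (hr hc1).1)
        (laxFraction_le_one (one_le_card_upTo hc1))
    · have he : (J.upTo 0).jobs = ∅ :=
        Finset.eq_empty_of_forall_notMem fun c hc => hrel ⟨c, hr hc⟩
      have hparts : (critDecide J α μ pick 0 J.p ∅ []).parts = [] := by
        rw [critDecide, if_neg hrel, List.map_nil]
      refine ⟨safe_critDecide_subset (Finset.empty_subset _), fun _ => le_rfl, fun _ _ => rfl,
        fun c hc => critical_critDecide hc, ?_, ?_, ?_, 0, le_rfl, fun _ => 0, ?_, ?_⟩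
      · rw [hparts, he]
        constructor <;> simp
      · rw [hparts]
        simp only [List.length_nil, Nat.cast_zero]
        positivity
      · rw [hparts]
        simp
      · rw [hparts]
        simp
      · rw [he]
        simp
  | succ t ih =>
    rw [critState_succ]
    exact ih.succ hα0 hα1 hμ hpick hJ

end Invariant


/-! ### The residues of the safe jobs -/

section Residues

variable {J : Instance} {α : ℝ} {μ : ℕ → ℕ} {pick : ℕ → ℕ → Finset ℕ → ℕ}

theorem CritInv.half_laxity₀_le_nextRem {t : ℕ} {s : CritState} (h : CritInv J α μ t s)
    (hα0 : 0 < α) (hμ : SplitsEnough α μ) (hJ : Admissible J) {c : ℕ}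
    (hc : c ∈ (J.upTo t).jobs \ s.safe) :
    1 / 2 * laxity₀ J c ≤ laxity J (s.nextRem J) (t + 1) c := by
  obtain ⟨τ, -, x, hA, hx⟩ := h.history
  obtain ⟨h1, h2, h3⟩ := hx c hc
  have hcr := (Finset.mem_sdiff.1 hc).1
  have hcJ := (mem_jobs_upTo.1 hcr).1
  exact half_laxity_le (by omega) hJ hcJ ((laxFraction_succ_mul_le hμ (one_le_card_upTo hcr)
    (hJ.laxity₀_nonneg hcJ) h1).trans (h.laxity_nextRem hα0 hμ hJ hA hc h2 h3).2)

theorem monotone_safe (J : Instance) (α : ℝ) (μ : ℕ → ℕ) (pick : ℕ → ℕ → Finset ℕ → ℕ) :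
    Monotone fun t => (critState J α μ pick t).safe :=
  monotone_nat_of_le_succ fun t => by
    rw [critState_succ]
    exact subset_safe_critDecide

/-- The time at which a job becomes safe. -/
noncomputable def safeTime (J : Instance) (α : ℝ) (μ : ℕ → ℕ) (pick : ℕ → ℕ → Finset ℕ → ℕ)
    (j : ℕ) : ℕ :=
  sInf {t | j ∈ (critState J α μ pick t).safe}

theorem rem_critState_succ (t j : ℕ) : (critState J α μ pick (t + 1)).rem j =
    (critState J α μ pick t).nextRem J j := rfl

theorem rem_critState_zero (j : ℕ) : (critState J α μ pick 0).rem j = J.p j := rfl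

theorem loose_of_mem_safe {t j : ℕ} (hj : j ∈ (critState J α μ pick t).safe) :
    ((critState J α μ pick (safeTime J α μ pick j)).rem j : ℝ) ≤
      α * ((J.d j : ℝ) - safeTime J α μ pick j) := by
  have hmem : j ∈ (critState J α μ pick (safeTime J α μ pick j)).safe :=
    Nat.sInf_mem (s := {t | j ∈ (critState J α μ pick t).safe}) ⟨t, hj⟩
  have hmin : ∀ u < safeTime J α μ pick j, j ∉ (critState J α μ pick u).safe := fun u hu =>
    Nat.notMem_of_lt_sInf (s := {t | j ∈ (critState J α μ pick t).safe}) hu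
  revert hmem hmin
  generalize safeTime J α μ pick j = u
  intro hmem hmin
  cases u with
  | zero =>
    rw [critState, critDecide] at hmem
    simp only [Finset.empty_union, Finset.mem_filter] at hmem
    exact hmem.2
  | succ u =>
    have h1 := hmin u (Nat.lt_succ_self u)
    rw [critState_succ, critDecide] at hmem
    simp only [Finset.mem_union, Finset.mem_filter] at hmem
    exact (hmem.resolve_left h1).2

theorem mem_safe_deadline (hS : ∀ t, CritInv J α μ t (critState J α μ pick t)) (hα0 : 0 < α)
    (hμ : SplitsEnough α μ) (hJ : Admissible J) {j : ℕ} (hj : j ∈ J.jobs) :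
    j ∈ (critState J α μ pick (J.d j)).safe := by
  by_contra h
  have h1 := hJ.release_add_le_deadline hj
  have h2 := (hS (J.d j)).lt_deadline hα0 hμ hJ
    (Finset.mem_sdiff.2 ⟨mem_jobs_upTo.2 ⟨hj, by omega⟩, h⟩)
  exact lt_irrefl _ h2.1

theorem mem_safe_iff (hS : ∀ t, CritInv J α μ t (critState J α μ pick t)) (hα0 : 0 < α)
    (hμ : SplitsEnough α μ) (hJ : Admissible J) {j : ℕ} (hj : j ∈ J.jobs) {t : ℕ} :
    j ∈ (critState J α μ pick t).safe ↔ safeTime J α μ pick j ≤ t := by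
  constructor
  · intro h
    exact Nat.sInf_le (s := {t | j ∈ (critState J α μ pick t).safe}) h
  · intro h
    exact monotone_safe J α μ pick h (Nat.sInf_mem (s := {t | j ∈ (critState J α μ pick t).safe})
      ⟨_, mem_safe_deadline hS hα0 hμ hJ hj⟩)

theorem release_le_safeTime (hS : ∀ t, CritInv J α μ t (critState J α μ pick t)) (hα0 : 0 < α)
    (hμ : SplitsEnough α μ) (hJ : Admissible J) {j : ℕ} (hj : j ∈ J.jobs) :
    J.r j ≤ safeTime J α μ pick j :=
  (mem_jobs_upTo.1 ((hS _).safe_subset ((mem_safe_iff hS hα0 hμ hJ hj).2 le_rfl))).2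

/-- Residues have at least half of the laxity of the original jobs. -/
theorem half_laxity₀_le_residue (hS : ∀ t, CritInv J α μ t (critState J α μ pick t))
    (hα0 : 0 < α) (hμ : SplitsEnough α μ) (hJ : Admissible J) {j : ℕ} (hj : j ∈ J.jobs) :
    1 / 2 * laxity₀ J j ≤ laxity J (critState J α μ pick (safeTime J α μ pick j)).rem
      (safeTime J α μ pick j) j := by
  have hr := release_le_safeTime hS hα0 hμ hJ hj
  have hl0 := hJ.laxity₀_nonneg hj
  have hmin : ∀ u < safeTime J α μ pick j, j ∉ (critState J α μ pick u).safe := fun u hu h =>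
    absurd ((mem_safe_iff hS hα0 hμ hJ hj).1 h) (not_le.2 hu)
  revert hr hmin
  generalize safeTime J α μ pick j = u
  intro hr hmin
  rcases hr.eq_or_lt with rfl | hr
  · have e : (critState J α μ pick (J.r j)).rem j = J.p j := by
      cases hrj : J.r j with
      | zero => rfl
      | succ u =>
        rw [rem_critState_succ]
        exact (hS u).nextRem_new (by omega)
    rw [laxity, e]
    rw [laxity₀] at hl0 ⊢
    linarith
  · obtain ⟨u, rfl⟩ := Nat.exists_eq_succ_of_ne_zero (show u ≠ 0 by omega)
    refine (hS u).half_laxity₀_le_nextRem hα0 hμ hJ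
      (Finset.mem_sdiff.2 ⟨mem_jobs_upTo.2 ⟨hj, by omega⟩, hmin u (Nat.lt_succ_self u)⟩)

theorem not_running_of_safe (hS : ∀ t, CritInv J α μ t (critState J α μ pick t)) {t j : ℕ}
    (h : j ∈ (critState J α μ pick t).safe) : some j ∉ (critState J α μ pick t).running J :=
  fun hr => (Finset.mem_sdiff.1 ((hS t).critical_of_running hr)).2 h

/-- The work done on `j` as a critical job and its remaining processing time add up. -/
theorem rem_add_card_running (hS : ∀ t, CritInv J α μ t (critState J α μ pick t)) (hα0 : 0 < α)
    (hμ : SplitsEnough α μ) (hJ : Admissible J) (j t : ℕ) :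
    (critState J α μ pick t).rem j + ((Finset.range t).filter fun u =>
      some j ∈ (critState J α μ pick u).running J).card = J.p j := by
  induction t with
  | zero => simp [rem_critState_zero]
  | succ t ih =>
    rw [rem_critState_succ, CritState.nextRem, Finset.range_add_one, Finset.filter_insert]
    split_ifs with h
    · have hpos := ((hS t).lt_deadline hα0 hμ hJ ((hS t).critical_of_running h)).2
      rw [Finset.card_insert_of_notMem (by simp)]
      omega
    · exact ih

theorem rem_eq_of_safe (hS : ∀ t, CritInv J α μ t (critState J α μ pick t)) {j u t : ℕ}
    (hu : j ∈ (critState J α μ pick u).safe) (hut : u ≤ t) :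
    (critState J α μ pick t).rem j = (critState J α μ pick u).rem j := by
  induction t, hut using Nat.le_induction with
  | base => rfl
  | succ t hut ih =>
    rw [rem_critState_succ, CritState.nextRem,
      if_neg (not_running_of_safe hS (monotone_safe J α μ pick hut hu)), ih]

theorem jobs_safeInstance (hS : ∀ t, CritInv J α μ t (critState J α μ pick t)) (hα0 : 0 < α)
    (hμ : SplitsEnough α μ) (hJ : Admissible J) :
    (safeInstance J α μ pick).jobs = J.jobs := by
  ext j
  simp only [safeInstance, Finset.mem_filter, and_iff_left_iff_imp]
  exact fun hj => ⟨_, mem_safe_deadline hS hα0 hμ hJ hj⟩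

/-- The residues whose window lies in `[a, b]` cause a load of at most `4 * opt J`: as their
laxities are within a factor of two of the original ones, all this work has to be done within
`[b - 4 * (b - a), b]` in any schedule of `J`. -/
theorem sum_residues_le (hS : ∀ t, CritInv J α μ t (critState J α μ pick t)) (hα0 : 0 < α)
    (hμ : SplitsEnough α μ) (hJ : Admissible J) {a b : ℕ} (hab : a < b) :
    ∑ j ∈ (safeInstance J α μ pick).jobs.filter
      (fun j => a ≤ (safeInstance J α μ pick).r j ∧ (safeInstance J α μ pick).d j ≤ b),
      (safeInstance J α μ pick).p j ≤ 4 * opt J * (b - a) := by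
  rw [jobs_safeInstance hS hα0 hμ hJ]
  refine (hJ.feasibleOn_opt.sum_forced_le (u := a - 3 * (b - a)) (v := b)
    (Finset.filter_subset _ _) _ ?_).trans ?_
  · intro j hj
    obtain ⟨hj, ha, hb⟩ := Finset.mem_filter.1 hj
    change a ≤ safeTime J α μ pick j at ha
    change J.d j ≤ b at hb
    change (critState J α μ pick (safeTime J α μ pick j)).rem j + _ + _ ≤ _
    have h1 := half_laxity₀_le_residue hS hα0 hμ hJ hj
    have h2 := release_le_safeTime hS hα0 hμ hJ hj
    have h3 := (hS (safeTime J α μ pick j)).rem_le j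
    have h4 := hJ.release_add_le_deadline hj
    have h5 := loose_of_mem_safe (mem_safe_deadline hS hα0 hμ hJ hj)
    have h0 := hJ.laxity₀_nonneg hj
    rw [laxity] at h1
    have h6 : (safeTime J α μ pick j : ℝ) ≤ J.d j := by
      have : (0 : ℝ) ≤ (critState J α μ pick (safeTime J α μ pick j)).rem j := Nat.cast_nonneg _
      linarith
    have h7 : safeTime J α μ pick j ≤ J.d j := by exact_mod_cast h6
    rw [laxity₀] at h1
    have h8 : (J.d j : ℝ) - J.r j - J.p j ≤ 2 * (J.d j - safeTime J α μ pick j -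
        (critState J α μ pick (safeTime J α μ pick j)).rem j) := by linarith
    have h9 : (J.d j : ℤ) - J.r j - J.p j ≤ 2 * (J.d j - safeTime J α μ pick j -
        (critState J α μ pick (safeTime J α μ pick j)).rem j) := by exact_mod_cast h8
    omega
  · rw [mul_comm 4, mul_assoc]
    exact Nat.mul_le_mul_left _ (by omega)

/-- The number of machines per unit of the optimum that suffices for EDF on the residues. -/
noncomputable def edfFactor (α : ℝ) : ℝ := (2 / (1 - α) + 1) * 4 * (2 / (1 - α))

theorem edfFactor_nonneg {α : ℝ} (hα1 : α < 1) : 0 ≤ edfFactor α := by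
  have : 0 < 1 - α := by linarith
  rw [edfFactor]
  positivity

theorem edfRem_safeInstance (hS : ∀ t, CritInv J α μ t (critState J α μ pick t)) (hα0 : 0 < α)
    (hα1 : α < 1) (hμ : SplitsEnough α μ) (hJ : Admissible J) {K : ℕ}
    (hK : edfFactor α * opt J ≤ K) {j : ℕ} (hj : j ∈ (safeInstance J α μ pick).jobs) :
    (safeInstance J α μ pick).edfRem K ((safeInstance J α μ pick).d j) j = 0 := by
  refine Instance.edfRem_deadline_eq_zero (α := α) (M := 4 * opt J) hα0.le hα1 (by positivity)
    ?_ ?_ ?_ hj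
  · intro i hi
    rw [jobs_safeInstance hS hα0 hμ hJ] at hi
    exact loose_of_mem_safe (mem_safe_deadline hS hα0 hμ hJ hi)
  · intro a b hab
    have := sum_residues_le (pick := pick) hS hα0 hμ hJ hab
    rw [← Nat.cast_sub hab.le]
    exact_mod_cast this
  · refine le_of_eq_of_le ?_ hK
    rw [edfFactor]
    ring

/-! ### The semi-online algorithm -/

theorem semiOnline_slot_eq_some {lam : ℝ} {m K q t j : ℕ} (hK : ⌈lam * m / (1 - α) ^ 2⌉₊ = K) :
    (semiOnline α μ lam pick m).slot J q t = some j ↔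
      (q < K ∧ (safeInstance J α μ pick).edfSlot K q t = some j) ∨
      (K ≤ q ∧ ∃ A, (critState J α μ pick t).parts.flatten[q - K]? = some A ∧
        (J.edfSort A).head? = some j) := by
  subst hK
  simp only [semiOnline]
  split_ifs with hq
  · simp [hq, not_le.2 hq]
  · rw [Option.join_eq_some_iff, CritState.running, List.getElem?_map]
    simp [hq, not_lt.1 hq]

theorem length_flatten_le (hS : ∀ t, CritInv J α μ t (critState J α μ pick t)) (hμm : Monotone μ)
    {N : ℕ} (hN : J.jobs.card ≤ N) (t : ℕ) :
    (critState J α μ pick t).parts.flatten.length ≤ ⌊6 * opt J / α + 1⌋₊ * μ N := by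
  rw [List.length_flatten]
  refine (List.sum_le_card_nsmul _ (μ N) ?_).trans ?_
  · intro k hk
    obtain ⟨l, hl, rfl⟩ := List.mem_map.1 hk
    rw [(hS t).length_sets l hl]
    exact hμm ((Finset.card_le_card (Finset.filter_subset _ _)).trans hN)
  · rw [List.length_map, smul_eq_mul]
    exact Nat.mul_le_mul_right _ (Nat.le_floor (hS t).length_parts)

theorem mem_opened_of_slot {lam : ℝ} {m q t j : ℕ}
    (h : (semiOnline α μ lam pick m).slot J q t = some j) :
    q ∈ (semiOnline α μ lam pick m).opened J t := by
  rcases (semiOnline_slot_eq_some rfl).1 h with ⟨hq, -⟩ | ⟨hq, A, hA, -⟩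
  · exact Or.inl hq
  · obtain ⟨h1, -⟩ := List.getElem?_eq_some_iff.1 hA
    refine Or.inr ⟨t, le_rfl, ?_⟩
    omega

/-- The semi-online algorithm finds a feasible schedule, and the number of its machines is at most
proportional to `m * μ N`. -/
theorem semiOnline_solvesWith (hS : ∀ t, CritInv J α μ t (critState J α μ pick t)) (hα0 : 0 < α)
    (hα1 : α < 1) (hμ : SplitsEnough α μ) (hμm : Monotone μ) (hJ : Admissible J) {lam : ℝ}
    (hlam : edfFactor α ≤ lam) {m N : ℕ} (hm : opt J ≤ m) (hN : J.jobs.card ≤ N) :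
    (semiOnline α μ lam pick m).SolvesWith J
      (lam * m / (1 - α) ^ 2 + 1 + (6 * m / α + 1) * μ N) := by
  have hlam0 : 0 ≤ lam := (edfFactor_nonneg hα1).trans hlam
  have hβ : 0 < 1 - α := by linarith
  have hmR : (opt J : ℝ) ≤ m := by exact_mod_cast hm
  obtain ⟨K, hK⟩ : ∃ K, ⌈lam * m / (1 - α) ^ 2⌉₊ = K := ⟨_, rfl⟩
  have hKle : edfFactor α * opt J ≤ K := by
    rw [← hK]
    refine le_trans ?_ (Nat.le_ceil _)
    calc edfFactor α * opt J ≤ lam * m := by gcongr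
      _ ≤ lam * m / (1 - α) ^ 2 := by
          rw [le_div_iff₀ (by positivity)]
          exact mul_le_of_le_one_right (by positivity) (by nlinarith)
  have hjobs := jobs_safeInstance hS hα0 hμ hJ
  have hfin := fun {j} hj => edfRem_safeInstance (j := j) hS hα0 hα1 hμ hJ hKle hj
  have hrange : (semiOnline α μ lam pick m).machines J ⊆
      Finset.range (K + ⌊6 * opt J / α + 1⌋₊ * μ N) := by
    rintro q ⟨t, hq⟩
    rw [Finset.mem_coe, Finset.mem_range]
    have hq' : q < K ∨ ∃ s ≤ t, q < K + (critState J α μ pick s).parts.flatten.length := by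
      rw [← hK]
      exact hq
    rcases hq' with hq' | ⟨s, -, hq'⟩
    · omega
    · have := length_flatten_le hS hμm hN s
      omega
  refine ⟨?_, fun q t j h => mem_opened_of_slot h, (Finset.finite_toSet _).subset hrange, ?_⟩
  · have hslot := fun q t j => semiOnline_slot_eq_some (J := J) (μ := μ) (pick := pick)
      (q := q) (t := t) (j := j) hK
    refine feasible_of_slots (slot := (semiOnline α μ lam pick m).slot J)
      (fun q t j h => ⟨t, mem_opened_of_slot h⟩) ?_ ?_ ?_
    · intro q t j h
      rcases (hslot q t j).1 h with ⟨-, h⟩ | ⟨-, A, hA, hAj⟩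
      · have hqu := Instance.mem_edfQueue_of_edfSlot h
        obtain ⟨hj, hr, -⟩ := Instance.active_of_mem_edfQueue hqu
        have hjJ : j ∈ J.jobs := hjobs ▸ hj
        exact ⟨hjJ, (release_le_safeTime hS hα0 hμ hJ hjJ).trans hr,
          Instance.lt_deadline_of_mem_edfQueue (J := safeInstance J α μ pick) (hfin hj) hqu⟩
      · have hT := (hS t).critical_of_running
          (CritState.mem_running.2 ⟨A, List.mem_of_getElem? hA, hAj⟩)
        obtain ⟨hj, hr⟩ := mem_jobs_upTo.1 (Finset.mem_sdiff.1 hT).1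
        exact ⟨hj, hr, ((hS t).lt_deadline hα0 hμ hJ hT).1⟩
    · -- A job is either safe or critical, and a critical job is in a single subset.
      have hexcl : ∀ {q t j}, (safeInstance J α μ pick).edfSlot K q t = some j →
          some j ∉ (critState J α μ pick t).running J := by
        intro q t j h
        obtain ⟨hj, hr, -⟩ :=
          Instance.active_of_mem_edfQueue (Instance.mem_edfQueue_of_edfSlot h)
        exact not_running_of_safe hS ((mem_safe_iff hS hα0 hμ hJ (hjobs ▸ hj)).2 hr)
      have hrun : ∀ {i t j A}, (critState J α μ pick t).parts.flatten[i]? = some A →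
          (J.edfSort A).head? = some j → some j ∈ (critState J α μ pick t).running J :=
        fun hA hAj => CritState.mem_running.2 ⟨_, List.mem_of_getElem? hA, hAj⟩
      intro q q' t j h h'
      rcases (hslot q t j).1 h with ⟨-, h⟩ | ⟨hq, A, hA, hAj⟩ <;>
        rcases (hslot q' t j).1 h' with ⟨-, h'⟩ | ⟨hq', A', hA', hAj'⟩
      · exact Instance.edfSlot_inj h h'
      · exact absurd (hrun hA' hAj') (hexcl h)
      · exact absurd (hrun hA hAj) (hexcl h')
      · obtain ⟨hi, rfl⟩ := List.getElem?_eq_some_iff.1 hA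
        obtain ⟨hi', rfl⟩ := List.getElem?_eq_some_iff.1 hA'
        have hd := List.pairwise_iff_getElem.1 (hS t).partition.disjoint
        have hj := Instance.mem_of_head?_edfSort hAj
        have hj' := Instance.mem_of_head?_edfSort hAj'
        rcases lt_trichotomy (q - K) (q' - K) with hlt | heq | hlt
        · exact absurd hj' (Finset.disjoint_left.1 (hd _ _ hi hi' hlt) hj)
        · omega
        · exact absurd hj (Finset.disjoint_left.1 (hd _ _ hi' hi hlt) hj')
    · intro j hj
      have hjL : j ∈ (safeInstance J α μ pick).jobs := by rwa [hjobs]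
      have hsafe := fun {t} => mem_safe_iff (t := t) hS hα0 hμ hJ hj
      have hdl := mem_safe_deadline hS hα0 hμ hJ hj
      have h1 := rem_add_card_running hS hα0 hμ hJ j (J.d j)
      have h2 := Instance.card_edf_slots (hfin hjL)
      have h3 : (critState J α μ pick (J.d j)).rem j = (safeInstance J α μ pick).p j :=
        rem_eq_of_safe hS (hsafe.2 le_rfl) (hsafe.1 hdl)
      -- The slots of `j` as a critical job, followed by those of its residue.
      refine ⟨((Finset.range (J.d j)).filter fun t =>
          some j ∈ (critState J α μ pick t).running J) ∪
        (Finset.range (J.d j)).filter fun t => j ∈ (safeInstance J α μ pick).edfQueue K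
          ((safeInstance J α μ pick).edfRem K t) t, ?_, ?_⟩
      · rw [Finset.card_union_of_disjoint]
        · change ((Finset.range (J.d j)).filter _).card = _ at h2
          omega
        · refine Finset.disjoint_left.2 fun t ht ht' => ?_
          have hq := Instance.active_of_mem_edfQueue (Finset.mem_filter.1 ht').2
          exact not_running_of_safe hS (hsafe.2 hq.2.1) (Finset.mem_filter.1 ht).2
      · intro t
        simp only [Finset.mem_union, Finset.mem_filter, Finset.mem_range, hslot]
        constructor
        · rintro (⟨-, h⟩ | ⟨-, h⟩)
          · obtain ⟨A, hA, hAj⟩ := CritState.mem_running.1 h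
            obtain ⟨i, hi⟩ := List.getElem?_of_mem hA
            exact ⟨K + i, Or.inr ⟨Nat.le_add_right _ _, A, by simpa using hi, hAj⟩⟩
          · obtain ⟨q, hq⟩ := Instance.exists_edfSlot_iff.2 h
            exact ⟨q, Or.inl ⟨Instance.lt_of_edfSlot hq, hq⟩⟩
        · rintro ⟨q, ⟨-, h⟩ | ⟨-, A, hA, hAj⟩⟩
          · have hq := Instance.mem_edfQueue_of_edfSlot h
            exact Or.inr ⟨Instance.lt_deadline_of_mem_edfQueue (J := safeInstance J α μ pick)
              (hfin hjL) hq, hq⟩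
          · have hr := CritState.mem_running.2 ⟨A, List.mem_of_getElem? hA, hAj⟩
            exact Or.inl ⟨((hS t).lt_deadline hα0 hμ hJ ((hS t).critical_of_running hr)).1, hr⟩
  · have hcard := Set.ncard_le_ncard hrange (Finset.finite_toSet _)
    rw [Set.ncard_coe_finset, Finset.card_range] at hcard
    refine le_trans (b := ((K + ⌊6 * opt J / α + 1⌋₊ * μ N : ℕ) : ℝ)) (by exact_mod_cast hcard) ?_
    push_cast
    gcongr
    · rw [← hK]
      exact (Nat.ceil_lt_add_one (by positivity)).le
    · refine (Nat.floor_le (by positivity)).trans ?_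
      gcongr

end Residues


/-! ### The semi-online algorithm is online -/

namespace AgreeUpTo

variable {J J' : Instance} {t T : ℕ}

theorem symm (h : AgreeUpTo J J' T) : AgreeUpTo J' J T :=
  ⟨h.1.symm, fun j hj => by
    obtain ⟨h1, h2, h3⟩ := h.2 j (h.1 ▸ hj)
    exact ⟨h1.symm, h2.symm, h3.symm⟩⟩

theorem mem_jobs (h : AgreeUpTo J J' T) {j : ℕ} (hj : j ∈ J.jobs) (hr : J.r j ≤ T) :
    j ∈ J'.jobs ∧ J.r j = J'.r j ∧ J.p j = J'.p j ∧ J.d j = J'.d j := by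
  have hm := mem_jobs_upTo.2 ⟨hj, hr⟩
  exact ⟨(mem_jobs_upTo.1 (h.1 ▸ hm)).1, h.2 j hm⟩

theorem mono (h : AgreeUpTo J J' T) (ht : t ≤ T) : AgreeUpTo J J' t := by
  have key : ∀ {J J' : Instance}, AgreeUpTo J J' T → ∀ j ∈ (J.upTo t).jobs,
      j ∈ (J'.upTo t).jobs := by
    intro J J' h j hj
    obtain ⟨hj, hr⟩ := mem_jobs_upTo.1 hj
    obtain ⟨h1, h2, -⟩ := h.mem_jobs hj (hr.trans ht)
    exact mem_jobs_upTo.2 ⟨h1, h2 ▸ hr⟩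
  refine ⟨Finset.Subset.antisymm (key h) (key h.symm), fun j hj => ?_⟩
  obtain ⟨hj, hr⟩ := mem_jobs_upTo.1 hj
  exact (h.mem_jobs hj (hr.trans ht)).2

end AgreeUpTo

section Congruence

variable {J J' : Instance} {t T : ℕ}

theorem edfQueue_congr (h : AgreeUpTo J J' t) (K : ℕ) {rem rem' : ℕ → ℕ}
    (hrem : ∀ j ∈ (J.upTo t).jobs, rem j = rem' j) :
    J.edfQueue K rem t = J'.edfQueue K rem' t := by
  have e : (J.jobs.filter fun j => J.r j ≤ t ∧ 0 < rem j) =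
      J'.jobs.filter fun j => J'.r j ≤ t ∧ 0 < rem' j := by
    have e1 : (J.jobs.filter fun j => J.r j ≤ t ∧ 0 < rem j) =
        (J.upTo t).jobs.filter fun j => 0 < rem j := by
      rw [Instance.upTo, Finset.filter_filter]
    have e2 : (J'.jobs.filter fun j => J'.r j ≤ t ∧ 0 < rem' j) =
        (J'.upTo t).jobs.filter fun j => 0 < rem' j := by
      rw [Instance.upTo, Finset.filter_filter]
    rw [e1, e2, ← h.1]
    exact Finset.filter_congr fun j hj => by rw [hrem j hj]
  rw [Instance.edfQueue, Instance.edfQueue, ← e, Instance.edfSort_congr]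
  intro j hj
  obtain ⟨hj, hr, -⟩ := Finset.mem_filter.1 hj
  obtain ⟨-, h1, -, h2⟩ := h.mem_jobs hj hr
  exact ⟨h1, h2⟩

theorem edfRem_congr (h : AgreeUpTo J J' T) (K : ℕ) (ht : t ≤ T) :
    ∀ j ∈ (J.upTo T).jobs, J.edfRem K t j = J'.edfRem K t j := by
  induction t with
  | zero => exact fun j hj => (h.2 j hj).2.1
  | succ t ih =>
    have ih := ih (by omega)
    have hq := edfQueue_congr (h.mono (show t ≤ T by omega)) K
      (rem := J.edfRem K t) (rem' := J'.edfRem K t) fun j hj => by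
        rw [mem_jobs_upTo] at hj
        exact ih j (mem_jobs_upTo.2 ⟨hj.1, by omega⟩)
    intro j hj
    simp only [Instance.edfRem]
    rw [hq, ih j hj]

theorem edfSlot_congr (h : AgreeUpTo J J' t) (K q : ℕ) : J.edfSlot K q t = J'.edfSlot K q t := by
  rw [Instance.edfSlot, Instance.edfSlot, edfQueue_congr h K (edfRem_congr h K le_rfl)]

variable {rem rem' : ℕ → ℕ} {pick : ℕ → ℕ → Finset ℕ → ℕ} {α : ℝ} {μ : ℕ → ℕ}

theorem candidates_congr {S : List (List ℕ)} {j : ℕ} (hj : J.d j = J'.d j)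
    (hS : ∀ l ∈ S, ∀ a ∈ l, J.d a = J'.d a ∧ rem a = rem' a) :
    candidates J rem t S j = candidates J' rem' t S j := by
  ext i
  rw [mem_candidates, mem_candidates]
  refine exists_congr fun a => exists_congr fun l => and_congr_right fun hl => ?_
  obtain ⟨h1, h2⟩ := hS _ (List.mem_of_getElem? hl) a (by simp)
  rw [Fits, Fits, hj, h1, h2]

theorem mem_of_mem_greedyAdd {S : List (List ℕ)} {j a : ℕ} {l : List ℕ}
    (hl : l ∈ greedyAdd J pick rem t S j) (ha : a ∈ l) : a = j ∨ ∃ l' ∈ S, a ∈ l' := by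
  rw [greedyAdd] at hl
  split_ifs at hl
  · obtain ⟨i, hi⟩ := List.getElem?_of_mem hl
    rw [List.getElem?_modify] at hi
    obtain ⟨l', hl', rfl⟩ := Option.map_eq_some_iff.1 hi
    have hm := List.mem_of_getElem? hl'
    split_ifs at ha
    · rcases List.mem_cons.1 ha with h | h
      · exact Or.inl h
      · exact Or.inr ⟨l', hm, h⟩
    · exact Or.inr ⟨l', hm, ha⟩
  · rcases List.mem_append.1 hl with h | h
    · exact Or.inr ⟨l, h, ha⟩
    · rw [List.mem_singleton.1 h] at ha
      exact Or.inl (List.mem_singleton.1 ha)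

theorem greedy_foldl_congr (Q : List ℕ) : ∀ S : List (List ℕ),
    (∀ j ∈ Q, J.d j = J'.d j ∧ rem j = rem' j) →
    (∀ l ∈ S, ∀ a ∈ l, J.d a = J'.d a ∧ rem a = rem' a) →
    Q.foldl (greedyAdd J pick rem t) S = Q.foldl (greedyAdd J' pick rem' t) S := by
  induction Q with
  | nil => intros; rfl
  | cons j Q ih =>
    intro S hQ hS
    have hj := hQ j (by simp)
    have e : greedyAdd J pick rem t S j = greedyAdd J' pick rem' t S j := by
      rw [greedyAdd, greedyAdd, candidates_congr hj.1 hS]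
    rw [List.foldl_cons, List.foldl_cons, ← e]
    refine ih _ (fun i hi => hQ i (List.mem_cons_of_mem _ hi)) fun l hl a ha => ?_
    rcases mem_of_mem_greedyAdd hl ha with rfl | ⟨l', hl', ha'⟩
    · exact hj
    · exact hS l' hl' a ha'

theorem greedySets_congr {A : Finset ℕ}
    (hA : ∀ j ∈ A, J.r j = J'.r j ∧ J.d j = J'.d j ∧ rem j = rem' j) :
    greedySets J pick rem t A = greedySets J' pick rem' t A := by
  rw [greedySets, greedySets,
    Instance.edfSort_congr (J' := J') fun j hj => ⟨(hA j hj).1, (hA j hj).2.1⟩]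
  refine greedy_foldl_congr _ [] (fun j hj => (hA j ?_).2) (by simp)
  exact Instance.mem_edfSort.1 (List.mem_reverse.1 hj)

theorem critDecide_congr (h : AgreeUpTo J J' t) (hrem : ∀ j ∈ (J.upTo t).jobs, rem j = rem' j)
    (safe : Finset ℕ) (parts : List (List (Finset ℕ))) :
    (critDecide J α μ pick t rem safe parts).safe =
        (critDecide J' α μ pick t rem' safe parts).safe ∧
      (critDecide J α μ pick t rem safe parts).parts =
        (critDecide J' α μ pick t rem' safe parts).parts := by
  have hsafe : (critDecide J α μ pick t rem safe parts).safe =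
      (critDecide J' α μ pick t rem' safe parts).safe := by
    simp only [critDecide]
    rw [← h.1]
    congr 1
    exact Finset.filter_congr fun j hj => by rw [hrem j hj, (h.2 j hj).2.2]
  refine ⟨hsafe, ?_⟩
  have hrel : ∀ {J J' : Instance}, AgreeUpTo J J' t → (∃ j ∈ J.jobs, J.r j = t) →
      ∃ j ∈ J'.jobs, J'.r j = t := by
    rintro J J' h ⟨j, hj, hr⟩
    obtain ⟨h1, h2, -⟩ := h.mem_jobs hj hr.le
    exact ⟨j, h1, h2 ▸ hr⟩
  have e : ∀ (J : Instance) (rem : ℕ → ℕ), (critDecide J α μ pick t rem safe parts).parts =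
      if ∃ j ∈ J.jobs, J.r j = t then
        (greedySets J pick rem t ((J.upTo t).jobs \
          (critDecide J α μ pick t rem safe parts).safe)).map (splitSet (μ (J.upTo t).jobs.card))
      else parts.map fun Si => Si.map fun A =>
        A \ (critDecide J α μ pick t rem safe parts).safe := fun _ _ => rfl
  rw [e, e, ← hsafe, ← h.1]
  by_cases hr : ∃ j ∈ J.jobs, J.r j = t
  · rw [if_pos hr, if_pos (hrel h hr), greedySets_congr]
    intro j hj
    obtain ⟨hj, -⟩ := Finset.mem_sdiff.1 hj
    exact ⟨(h.2 j hj).1, (h.2 j hj).2.2, hrem j hj⟩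
  · rw [if_neg hr, if_neg fun hr' => hr (hrel h.symm hr')]

theorem running_congr {s s' : CritState} (h : AgreeUpTo J J' t) (hparts : s.parts = s'.parts)
    (hs : CritInv J α μ t s) : s.running J = s'.running J' := by
  rw [CritState.running, CritState.running, ← hparts]
  refine List.map_congr_left fun A hA => ?_
  rw [Instance.edfSort_congr]
  intro j hj
  have := h.2 j (Finset.mem_sdiff.1 (hs.partition.subset A hA hj)).1
  exact ⟨this.1, this.2.2⟩

theorem critState_congr (hS : ∀ t, CritInv J α μ t (critState J α μ pick t))
    (h : AgreeUpTo J J' T) (ht : t ≤ T) :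
    (critState J α μ pick t).safe = (critState J' α μ pick t).safe ∧
      (critState J α μ pick t).parts = (critState J' α μ pick t).parts ∧
      ∀ j ∈ (J.upTo T).jobs, (critState J α μ pick t).rem j = (critState J' α μ pick t).rem j := by
  have hup : ∀ {u}, u ≤ T → ∀ j ∈ (J.upTo u).jobs, j ∈ (J.upTo T).jobs := fun hu j hj => by
    rw [mem_jobs_upTo] at hj ⊢
    exact ⟨hj.1, hj.2.trans hu⟩
  induction t with
  | zero =>
    have hrem : ∀ j ∈ (J.upTo T).jobs, J.p j = J'.p j := fun j hj => (h.2 j hj).2.1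
    obtain ⟨h1, h2⟩ := critDecide_congr (α := α) (μ := μ) (pick := pick) (h.mono ht)
      (fun j hj => hrem j (hup ht j hj)) ∅ []
    exact ⟨h1, h2, hrem⟩
  | succ t ih =>
    obtain ⟨h1, h2, h3⟩ := ih (by omega)
    have hrun := running_congr (h.mono (show t ≤ T by omega)) h2 (hS t)
    have hrem : ∀ j ∈ (J.upTo T).jobs, (critState J α μ pick t).nextRem J j =
        (critState J' α μ pick t).nextRem J' j := by
      intro j hj
      rw [CritState.nextRem, CritState.nextRem, hrun, h3 j hj]
    rw [critState_succ, critState_succ, ← h1, ← h2]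
    obtain ⟨h4, h5⟩ := critDecide_congr (α := α) (μ := μ) (pick := pick) (h.mono ht)
      (fun j hj => hrem j (hup ht j hj)) (critState J α μ pick t).safe
      (critState J α μ pick t).parts
    exact ⟨h4, h5, hrem⟩

theorem mem_upTo_safeInstance (hS : ∀ t, CritInv J α μ t (critState J α μ pick t)) (hα0 : 0 < α)
    (hμ : SplitsEnough α μ) (hJ : Admissible J) {j : ℕ} :
    j ∈ ((safeInstance J α μ pick).upTo T).jobs ↔ j ∈ (critState J α μ pick T).safe := by
  rw [mem_jobs_upTo, jobs_safeInstance hS hα0 hμ hJ]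
  constructor
  · rintro ⟨hj, hr⟩
    exact (mem_safe_iff hS hα0 hμ hJ hj).2 hr
  · intro h
    have hj := (mem_jobs_upTo.1 ((hS T).safe_subset h)).1
    exact ⟨hj, (mem_safe_iff hS hα0 hμ hJ hj).1 h⟩

theorem agreeUpTo_safeInstance (hS : ∀ t, CritInv J α μ t (critState J α μ pick t))
    (hS' : ∀ t, CritInv J' α μ t (critState J' α μ pick t)) (hα0 : 0 < α)
    (hμ : SplitsEnough α μ) (hJ : Admissible J) (hJ' : Admissible J') (h : AgreeUpTo J J' T) :
    AgreeUpTo (safeInstance J α μ pick) (safeInstance J' α μ pick) T := by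
  have hsafe := fun {t} ht => (critState_congr (t := t) hS h ht).1
  constructor
  · ext j
    rw [mem_upTo_safeInstance hS hα0 hμ hJ, mem_upTo_safeInstance hS' hα0 hμ hJ', hsafe le_rfl]
  · intro j hj
    have hjT := (mem_upTo_safeInstance hS hα0 hμ hJ).1 hj
    have hjup := (hS T).safe_subset hjT
    have hjJ := (mem_jobs_upTo.1 hjup).1
    have hjT' := hjT
    rw [hsafe le_rfl] at hjT'
    have hjJ' := (mem_jobs_upTo.1 ((hS' T).safe_subset hjT')).1
    have hle := (mem_safe_iff hS hα0 hμ hJ hjJ).1 hjT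
    have hle' := (mem_safe_iff hS' hα0 hμ hJ' hjJ').1 hjT'
    have htime : safeTime J α μ pick j = safeTime J' α μ pick j := by
      apply le_antisymm
      · rw [← mem_safe_iff hS hα0 hμ hJ hjJ, hsafe hle']
        exact (mem_safe_iff hS' hα0 hμ hJ' hjJ').2 le_rfl
      · rw [← mem_safe_iff hS' hα0 hμ hJ' hjJ', ← hsafe hle]
        exact (mem_safe_iff hS hα0 hμ hJ hjJ).2 le_rfl
    refine ⟨htime, ?_, (h.2 j hjup).2.2⟩
    change (critState J α μ pick (safeTime J α μ pick j)).rem j =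
      (critState J' α μ pick (safeTime J' α μ pick j)).rem j
    rw [← htime]
    exact (critState_congr hS h hle).2.2 j hjup

theorem isOnline_semiOnline (hα0 : 0 < α) (hα1 : α < 1) (hμ : SplitsEnough α μ)
    (hpick : IsChoiceRule pick) (lam : ℝ) (m : ℕ) : (semiOnline α μ lam pick m).IsOnline := by
  intro J J' hJ hJ' T h
  have hS := critInv_critState hα0 hα1 hμ hpick hJ
  have hS' := critInv_critState hα0 hα1 hμ hpick hJ'
  constructor
  · intro q
    simp only [semiOnline]
    rw [edfSlot_congr (agreeUpTo_safeInstance hS hS' hα0 hμ hJ hJ' h),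
      running_congr h (critState_congr hS h le_rfl).2.1 (hS T)]
  · ext q
    simp only [semiOnline, Set.mem_ofPred_eq]
    refine or_congr_right (exists_congr fun s => and_congr_right fun hs => ?_)
    rw [(critState_congr hS h hs).2.1]

end Congruence


/-! ### The phases of Double -/

theorem iInf_natCast_le_iff {ι : Type*} {P : ι → Prop} {f : ι → ℕ} {u : ℕ} :
    (⨅ (i : ι) (_ : P i), (f i : ℕ∞)) ≤ u ↔ ∃ i, P i ∧ f i ≤ u := by
  constructor
  · intro h
    by_contra hne
    have h1 : ((u + 1 : ℕ) : ℕ∞) ≤ ⨅ (i : ι) (_ : P i), (f i : ℕ∞) := by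
      refine le_iInf₂ fun i hi => ?_
      have : ¬ f i ≤ u := fun hle => hne ⟨i, hi, hle⟩
      exact_mod_cast (by omega : u + 1 ≤ f i)
    have h2 : u + 1 ≤ u := by exact_mod_cast h1.trans h
    omega
  · rintro ⟨i, hi, hle⟩
    exact iInf₂_le_of_le i hi (by exact_mod_cast hle)

section Phases

variable {J J' : Instance}

theorem subInstance_upTo (J : Instance) (t : ℕ) : SubInstance (J.upTo t) J :=
  ⟨Finset.filter_subset _ _, fun _ _ => ⟨rfl, rfl, rfl⟩⟩

theorem subInstance_upTo_upTo (J : Instance) {s t : ℕ} (h : s ≤ t) :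
    SubInstance (J.upTo s) (J.upTo t) :=
  ⟨fun j hj => by
    rw [mem_jobs_upTo] at hj ⊢
    exact ⟨hj.1, hj.2.trans h⟩, fun _ _ => ⟨rfl, rfl, rfl⟩⟩

theorem subInstance_phase (J : Instance) (i : ℕ) : SubInstance (phase J i) J := by
  refine ⟨fun j hj => ?_, fun _ _ => ⟨rfl, rfl, rfl⟩⟩
  simp only [phase, Finset.mem_filter] at hj
  exact hj.1

theorem mem_phase {i j : ℕ} : j ∈ (phase J i).jobs ↔
    j ∈ J.jobs ∧ phaseStart J i ≤ (J.r j : ℕ∞) ∧ (J.r j : ℕ∞) < phaseStart J (i + 1) := by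
  simp only [phase, Finset.mem_filter]

theorem opt_upTo_mono (hJ : Admissible J) {s t : ℕ} (h : s ≤ t) :
    opt (J.upTo s) ≤ opt (J.upTo t) :=
  opt_mono (hJ.of_subInstance (subInstance_upTo J t)) (subInstance_upTo_upTo J h)

theorem opt_upTo_le (hJ : Admissible J) (t : ℕ) : opt (J.upTo t) ≤ opt J :=
  opt_mono hJ (subInstance_upTo J t)

theorem opt_eq_zero_of_empty (h : J.jobs = ∅) : opt J = 0 := by
  refine Nat.le_zero.1 (opt_le ⟨fun q => q.elim0, ?_⟩)
  constructor
  · exact fun q => q.elim0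
  · exact fun q => q.elim0
  · exact fun q => q.elim0
  · exact fun q => q.elim0
  · exact fun q => q.elim0
  · simp [h]

theorem opt_upTo_congr (hJ : Admissible J) (hJ' : Admissible J') {T s : ℕ}
    (h : AgreeUpTo J J' T) (hs : s ≤ T) : opt (J.upTo s) = opt (J'.upTo s) := by
  have hs := h.mono hs
  apply le_antisymm
  · exact opt_mono (hJ'.of_subInstance (subInstance_upTo J' s))
      ⟨hs.1.subset, fun j hj => hs.symm.2 j (hs.1 ▸ hj)⟩
  · exact opt_mono (hJ.of_subInstance (subInstance_upTo J s))
      ⟨hs.1.symm.subset, fun j hj => hs.2 j (hs.1 ▸ hj)⟩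

theorem phaseStart_zero_le_iff {u : ℕ} : phaseStart J 0 ≤ u ↔ ∃ j ∈ J.jobs, J.r j ≤ u := by
  rw [phaseStart, iInf_natCast_le_iff]

theorem phaseStart_succ_le_iff {i u : ℕ} : phaseStart J (i + 1) ≤ u ↔
    ∃ t : ℕ, (∃ s : ℕ, phaseStart J i = s ∧ 2 * opt (J.upTo s) < opt (J.upTo t)) ∧ t ≤ u := by
  rw [phaseStart, iInf_natCast_le_iff (f := fun t : ℕ => t)]

theorem eq_natCast_of_le_iff {a b : ℕ∞} {T s : ℕ} (h : ∀ u ≤ T, a ≤ (u : ℕ∞) ↔ b ≤ (u : ℕ∞))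
    (ha : a = s) (hs : s ≤ T) : b = s := by
  have hb : b ≤ s := (h s hs).1 ha.le
  obtain ⟨s', rfl⟩ := ENat.ne_top_iff_exists.1 (ne_top_of_le_ne_top (ENat.natCast_ne_top s) hb)
  have hs' : s' ≤ s := by exact_mod_cast hb
  have h1 := (h s' (by omega)).2 le_rfl
  rw [ha] at h1
  have h2 : s ≤ s' := by exact_mod_cast h1
  rw [le_antisymm hs' h2]

/-- A finite `t_{i+1}` comes with a finite `t_i` and the optimum has more than doubled. -/
theorem phaseStart_succ_eq {i t : ℕ} (h : phaseStart J (i + 1) = t) :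
    ∃ s : ℕ, phaseStart J i = s ∧ 2 * opt (J.upTo s) < opt (J.upTo t) := by
  obtain ⟨t', ht', hle⟩ := phaseStart_succ_le_iff.1 h.le
  have h1 := phaseStart_succ_le_iff.2 ⟨t', ht', le_rfl⟩
  rw [h] at h1
  have h2 : t ≤ t' := by exact_mod_cast h1
  rwa [le_antisymm h2 hle]

theorem phaseStart_lt_succ (hJ : Admissible J) {i s : ℕ} (h : phaseStart J i = s) :
    ((s + 1 : ℕ) : ℕ∞) ≤ phaseStart J (i + 1) := by
  by_contra hlt
  rw [not_le, Nat.cast_add, Nat.cast_one, ENat.lt_add_one_iff (by simp)] at hlt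
  obtain ⟨t, ⟨s', hs', hopt⟩, hts⟩ := phaseStart_succ_le_iff.1 hlt
  rw [h] at hs'
  have hss : s = s' := by exact_mod_cast hs'
  subst hss
  have := opt_upTo_mono hJ hts
  omega

theorem phaseStart_mono (hJ : Admissible J) : Monotone (phaseStart J) := by
  refine monotone_nat_of_le_succ fun i => ?_
  by_cases hi : phaseStart J (i + 1) = ⊤
  · rw [hi]
    exact le_top
  · obtain ⟨t, ht⟩ := ENat.ne_top_iff_exists.1 hi
    obtain ⟨s, hs, -⟩ := phaseStart_succ_eq ht.symm
    refine le_trans ?_ (phaseStart_lt_succ hJ hs)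
    rw [hs]
    exact_mod_cast Nat.le_succ s

theorem le_phaseStart (hJ : Admissible J) (i : ℕ) : (i : ℕ∞) ≤ phaseStart J i := by
  induction i with
  | zero => simp
  | succ i ih =>
    by_cases hi : phaseStart J (i + 1) = ⊤
    · rw [hi]
      exact le_top
    · obtain ⟨t, ht⟩ := ENat.ne_top_iff_exists.1 hi
      obtain ⟨s, hs, -⟩ := phaseStart_succ_eq ht.symm
      refine le_trans ?_ (phaseStart_lt_succ hJ hs)
      rw [hs] at ih
      have h1 : i ≤ s := by exact_mod_cast ih
      exact_mod_cast Nat.succ_le_succ h1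

theorem exists_mem_phase (hJ : Admissible J) {j : ℕ} (hj : j ∈ J.jobs) :
    ∃ i, j ∈ (phase J i).jobs := by
  classical
  have hex : ∃ i, (J.r j : ℕ∞) < phaseStart J (i + 1) := by
    refine ⟨J.r j, lt_of_lt_of_le ?_ (le_phaseStart hJ _)⟩
    exact_mod_cast Nat.lt_succ_self _
  refine ⟨Nat.find hex, mem_phase.2 ⟨hj, ?_, Nat.find_spec hex⟩⟩
  cases hi : Nat.find hex with
  | zero => exact phaseStart_zero_le_iff.2 ⟨j, hj, le_rfl⟩
  | succ i => exact not_lt.1 (Nat.find_min hex (m := i) (by omega))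

theorem phase_unique (hJ : Admissible J) {i i' j : ℕ} (h : j ∈ (phase J i).jobs)
    (h' : j ∈ (phase J i').jobs) : i = i' := by
  have key : ∀ {i i'}, j ∈ (phase J i).jobs → j ∈ (phase J i').jobs → ¬ i < i' := by
    intro i i' h h' hlt
    have h1 := (mem_phase.1 h).2.2
    have h2 := (mem_phase.1 h').2.1
    exact absurd (phaseStart_mono hJ (Nat.succ_le_of_lt hlt)) (not_le.2 (h2.trans_lt h1))
  have := key h h'
  have := key h' h
  omega

/-- Before `t_{i+1}` the optimum is at most `2 m(t_i)`. -/
theorem opt_phase_le (hJ : Admissible J) (i : ℕ) : opt (phase J i) ≤ phaseGuess J i := by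
  rcases (phase J i).jobs.eq_empty_or_nonempty with he | hne
  · rw [opt_eq_zero_of_empty he]
    exact Nat.zero_le _
  · obtain ⟨j, hj, hmax⟩ := (phase J i).jobs.exists_max_image J.r hne
    obtain ⟨-, h1, h2⟩ := mem_phase.1 hj
    obtain ⟨s, hs⟩ := ENat.ne_top_iff_exists.1 (ne_top_of_le_ne_top (ENat.natCast_ne_top _) h1)
    have h3 : opt (phase J i) ≤ opt (J.upTo (J.r j)) := by
      refine opt_mono (hJ.of_subInstance (subInstance_upTo J _)) ⟨fun k hk => ?_, fun _ _ =>
        ⟨rfl, rfl, rfl⟩⟩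
      exact mem_jobs_upTo.2 ⟨(mem_phase.1 hk).1, hmax k hk⟩
    refine h3.trans ?_
    rw [phaseGuess, ← hs, ENat.toNat_natCast]
    by_contra hlt
    exact absurd (phaseStart_succ_le_iff.2 ⟨J.r j, ⟨s, hs.symm, not_le.1 hlt⟩, le_rfl⟩)
      (not_le.2 h2)

theorem lt_phaseGuess (hJ : Admissible J) {i : ℕ} (hi : phaseStart J i ≠ ⊤) :
    i < phaseGuess J i := by
  induction i with
  | zero =>
    obtain ⟨t, ht⟩ := ENat.ne_top_iff_exists.1 hi
    obtain ⟨j, hj, hr⟩ := phaseStart_zero_le_iff.1 ht.symm.le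
    have := (hJ.of_subInstance (subInstance_upTo J t)).one_le_opt ⟨j, mem_jobs_upTo.2 ⟨hj, hr⟩⟩
    rw [phaseGuess, ← ht, ENat.toNat_natCast]
    omega
  | succ i ih =>
    obtain ⟨t, ht⟩ := ENat.ne_top_iff_exists.1 hi
    obtain ⟨s, hs, hopt⟩ := phaseStart_succ_eq ht.symm
    have h1 := ih (hs ▸ ENat.natCast_ne_top s)
    rw [phaseGuess, hs, ENat.toNat_natCast] at h1
    rw [phaseGuess, ← ht, ENat.toNat_natCast]
    omega

theorem phaseGuess_le (hJ : Admissible J) (i : ℕ) : phaseGuess J i ≤ 2 * opt J :=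
  Nat.mul_le_mul_left 2 (opt_upTo_le hJ _)

open scoped Classical in
/-- The guesses grow geometrically, so their sum is dominated by the last one. -/
theorem sum_phaseGuess_le (hJ : Admissible J) (n : ℕ) :
    ∑ i ∈ (Finset.range n).filter (fun i => phaseStart J i ≠ ⊤), phaseGuess J i ≤ 4 * opt J := by
  have key : ∀ n, phaseStart J n ≠ ⊤ →
      ∑ i ∈ (Finset.range n).filter (fun i => phaseStart J i ≠ ⊤), phaseGuess J i ≤
        phaseGuess J n := by
    intro n
    induction n with
    | zero => simp
    | succ n ih =>
      intro hn
      obtain ⟨t, ht⟩ := ENat.ne_top_iff_exists.1 hn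
      obtain ⟨s, hs, hopt⟩ := phaseStart_succ_eq ht.symm
      have hsn : phaseStart J n ≠ ⊤ := hs ▸ ENat.natCast_ne_top s
      have h1 := ih hsn
      rw [Finset.range_add_one, Finset.filter_insert, if_pos hsn, Finset.sum_insert (by simp)]
      have e1 : phaseGuess J n = 2 * opt (J.upTo s) := by rw [phaseGuess, hs, ENat.toNat_natCast]
      have e2 : phaseGuess J (n + 1) = 2 * opt (J.upTo t) := by
        rw [phaseGuess, ← ht, ENat.toNat_natCast]
      omega
  induction n with
  | zero => simp
  | succ n ih =>
    rw [Finset.range_add_one, Finset.filter_insert]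
    split_ifs with hn
    · rw [Finset.sum_insert (by simp)]
      have h1 := key n hn
      have h2 := phaseGuess_le hJ n
      omega
    · exact ih

theorem phaseStart_congr (hJ : Admissible J) (hJ' : Admissible J') {T : ℕ}
    (h : AgreeUpTo J J' T) (i : ℕ) :
    ∀ u ≤ T, phaseStart J i ≤ (u : ℕ∞) ↔ phaseStart J' i ≤ (u : ℕ∞) := by
  induction i with
  | zero =>
    have key : ∀ {J J' : Instance}, AgreeUpTo J J' T → ∀ u ≤ T, phaseStart J 0 ≤ (u : ℕ∞) →
        phaseStart J' 0 ≤ (u : ℕ∞) := by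
      intro J J' h u hu hle
      obtain ⟨j, hj, hr⟩ := phaseStart_zero_le_iff.1 hle
      obtain ⟨h1, h2, -⟩ := h.mem_jobs hj (hr.trans hu)
      exact phaseStart_zero_le_iff.2 ⟨j, h1, h2 ▸ hr⟩
    exact fun u hu => ⟨key h u hu, key h.symm u hu⟩
  | succ i ih =>
    have key : ∀ {J J' : Instance}, Admissible J → Admissible J' → AgreeUpTo J J' T →
        (∀ u ≤ T, phaseStart J i ≤ (u : ℕ∞) ↔ phaseStart J' i ≤ (u : ℕ∞)) →
        ∀ u ≤ T, phaseStart J (i + 1) ≤ (u : ℕ∞) → phaseStart J' (i + 1) ≤ (u : ℕ∞) := by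
      intro J J' hJ hJ' h ih u hu hle
      obtain ⟨t, ⟨s, hs, hopt⟩, htu⟩ := phaseStart_succ_le_iff.1 hle
      have hst : s ≤ t := by
        by_contra hlt
        have := opt_upTo_mono hJ (not_le.1 hlt).le
        omega
      refine phaseStart_succ_le_iff.2 ⟨t, ⟨s, eq_natCast_of_le_iff ih hs (by omega), ?_⟩, htu⟩
      rwa [← opt_upTo_congr hJ hJ' h (show s ≤ T by omega),
        ← opt_upTo_congr hJ hJ' h (show t ≤ T by omega)]
    exact fun u hu => ⟨key hJ hJ' h ih u hu, key hJ' hJ h.symm (fun u hu => (ih u hu).symm) u hu⟩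

theorem agreeUpTo_phase (hJ : Admissible J) (hJ' : Admissible J') {T : ℕ}
    (h : AgreeUpTo J J' T) (i : ℕ) : AgreeUpTo (phase J i) (phase J' i) T := by
  have key : ∀ {J J' : Instance}, Admissible J → Admissible J' → AgreeUpTo J J' T →
      ∀ j ∈ ((phase J i).upTo T).jobs, j ∈ ((phase J' i).upTo T).jobs := by
    intro J J' hJ hJ' h j hj
    obtain ⟨hj, hr⟩ := mem_jobs_upTo.1 hj
    obtain ⟨hj, h1, h2⟩ := mem_phase.1 hj
    change J.r j ≤ T at hr
    obtain ⟨h3, h4, -⟩ := h.mem_jobs hj hr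
    have h5 := (phaseStart_congr hJ hJ' h i _ hr).1 h1
    have h6 := fun hle => not_le.2 h2 ((phaseStart_congr hJ hJ' h (i + 1) _ hr).2 hle)
    rw [h4] at h5 h6 hr
    exact mem_jobs_upTo.2 ⟨mem_phase.2 ⟨h3, h5, not_le.1 h6⟩, hr⟩
  refine ⟨Finset.Subset.antisymm (key hJ hJ' h) (key hJ' hJ h.symm), fun j hj => ?_⟩
  obtain ⟨hj, hr⟩ := mem_jobs_upTo.1 hj
  exact (h.mem_jobs (mem_phase.1 hj).1 hr).2

end Phases

/-! ### Algorithm Double -/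

section Double

variable {κ : Type} {A : ℕ → Algorithm κ} {J : Instance} {B : ℝ}

theorem Algorithm.SolvesWith.window {A : Algorithm κ} (h : A.SolvesWith J B) {q : κ} {t j : ℕ}
    (hs : A.slot J q t = some j) : j ∈ J.jobs ∧ J.r j ≤ t := by
  have e : A.schedule J q (t : ℝ) = some j := by
    rw [Algorithm.schedule, if_pos (Nat.cast_nonneg t), Nat.floor_natCast, hs]
  refine ⟨h.1.job_mem _ _ _ e, ?_⟩
  exact_mod_cast (h.1.window _ _ _ e).1

theorem double_slot_phase {F : Instance → ℕ → ℝ} (hJ : Admissible J)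
    (hA : ∀ (J : Instance) (m : ℕ), Admissible J → opt J ≤ m → (A m).SolvesWith J (F J m))
    {i : ℕ} {q : κ} {t j : ℕ} (h : (double A).slot J (i, q) t = some j) :
    j ∈ (phase J i).jobs ∧ phaseStart J i ≤ (t : ℕ∞) := by
  obtain ⟨h1, h2⟩ := (hA _ _ (hJ.of_subInstance (subInstance_phase J i))
    (opt_phase_le hJ i)).window h
  refine ⟨h1, (mem_phase.1 h1).2.1.trans ?_⟩
  exact_mod_cast h2

/-- Double is online: whether a phase has begun, its guess, and its jobs depend only on the jobs
released so far, and nothing is done for a phase that has not begun. -/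
theorem isOnline_double {F : Instance → ℕ → ℝ} (hon : ∀ m, (A m).IsOnline)
    (hA : ∀ (J : Instance) (m : ℕ), Admissible J → opt J ≤ m → (A m).SolvesWith J (F J m)) :
    (double A).IsOnline := by
  intro J J' hJ hJ' T h
  have hph := phaseStart_congr hJ hJ' h
  have hact : ∀ i, phaseStart J i ≤ (T : ℕ∞) →
      (∀ q, (A (phaseGuess J i)).slot (phase J i) q T =
        (A (phaseGuess J' i)).slot (phase J' i) q T) ∧
      (A (phaseGuess J i)).opened (phase J i) T =
        (A (phaseGuess J' i)).opened (phase J' i) T := by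
    intro i hi
    obtain ⟨s, hs⟩ := ENat.ne_top_iff_exists.1 (ne_top_of_le_ne_top (ENat.natCast_ne_top _) hi)
    have hsT : s ≤ T := by
      rw [← hs] at hi
      exact_mod_cast hi
    have hg : phaseGuess J i = phaseGuess J' i := by
      rw [phaseGuess, phaseGuess, eq_natCast_of_le_iff (hph i) hs.symm hsT, ← hs,
        ENat.toNat_natCast, opt_upTo_congr hJ hJ' h hsT]
    rw [← hg]
    exact hon _ _ _ (hJ.of_subInstance (subInstance_phase J i))
      (hJ'.of_subInstance (subInstance_phase J' i)) T (agreeUpTo_phase hJ hJ' h i)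
  constructor
  · rintro ⟨i, q⟩
    by_cases hi : phaseStart J i ≤ (T : ℕ∞)
    · exact (hact i hi).1 q
    · have hi' : ¬ phaseStart J' i ≤ (T : ℕ∞) := fun hle => hi ((hph i T le_rfl).2 hle)
      have e : (double A).slot J (i, q) T = none := by
        refine Option.eq_none_iff_forall_ne_some.2 fun j hj => ?_
        exact hi (double_slot_phase hJ hA hj).2
      have e' : (double A).slot J' (i, q) T = none := by
        refine Option.eq_none_iff_forall_ne_some.2 fun j hj => ?_
        exact hi' (double_slot_phase hJ' hA hj).2
      rw [e, e']
  · ext ⟨i, q⟩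
    simp only [double, Set.mem_ofPred_eq]
    rw [hph i T le_rfl]
    refine and_congr_right fun hi => ?_
    rw [(hact i ((hph i T le_rfl).2 hi)).2]

/-- Double combines the schedules of the phases. As the guesses grow geometrically, it needs at
most `4 * c * opt J` machines if `A m` needs at most `c * m`. -/
theorem double_solvesWith {F : Instance → ℕ → ℝ} {c : ℝ} (hJ : Admissible J)
    (hA : ∀ (J : Instance) (m : ℕ), Admissible J → opt J ≤ m → (A m).SolvesWith J (F J m))
    (hc : 0 ≤ c)
    (hF : ∀ i, phaseStart J i ≠ ⊤ → F (phase J i) (phaseGuess J i) ≤ c * phaseGuess J i) :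
    (double A).SolvesWith J (4 * c * opt J) := by
  classical
  have hsol : ∀ i, (A (phaseGuess J i)).SolvesWith (phase J i) (F (phase J i) (phaseGuess J i)) :=
    fun i => hA _ _ (hJ.of_subInstance (subInstance_phase J i)) (opt_phase_le hJ i)
  have hopened : ∀ iq t j, (double A).slot J iq t = some j → iq ∈ (double A).opened J t :=
    fun iq t j h => ⟨(double_slot_phase hJ hA h).2, (hsol iq.1).2.1 _ _ _ h⟩
  have hsched : ∀ i q x, (double A).schedule J (i, q) x =
      (A (phaseGuess J i)).schedule (phase J i) q x := fun _ _ _ => rfl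
  set I := (Finset.range (2 * opt J)).filter fun i => phaseStart J i ≠ ⊤ with hI
  have hsub : (double A).machines J ⊆
      ⋃ i ∈ I, Prod.mk i '' (A (phaseGuess J i)).machines (phase J i) := by
    rintro ⟨i, q⟩ ⟨t, hi, hq⟩
    have hne : phaseStart J i ≠ ⊤ := ne_top_of_le_ne_top (ENat.natCast_ne_top t) hi
    simp only [Set.mem_iUnion]
    refine ⟨i, Finset.mem_filter.2 ⟨Finset.mem_range.2 ?_, hne⟩, q, ⟨t, hq⟩, rfl⟩
    exact (lt_phaseGuess hJ hne).trans_le (phaseGuess_le hJ i)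
  have hfin : (⋃ i ∈ I, Prod.mk i '' (A (phaseGuess J i)).machines (phase J i)).Finite :=
    I.finite_toSet.biUnion fun i _ => (hsol i).2.2.1.image _
  refine ⟨?_, hopened, hfin.subset hsub, ?_⟩
  · constructor
    · rintro ⟨i, q⟩ x j h
      have h' := h
      rw [Algorithm.schedule] at h'
      split_ifs at h'
      exact ⟨_, hopened _ _ _ h'⟩
    · rintro ⟨i, q⟩ x j h
      rw [hsched] at h
      exact (subInstance_phase J i).1 ((hsol i).1.job_mem _ _ _ h)
    · rintro ⟨i, q⟩ x j h
      rw [hsched] at h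
      exact (hsol i).1.window _ _ _ h
    · rintro ⟨i, q⟩ ⟨i', q'⟩ x j h h'
      rw [hsched] at h h'
      obtain rfl := phase_unique hJ ((hsol i).1.job_mem _ _ _ h) ((hsol i').1.job_mem _ _ _ h')
      rw [(hsol i).1.not_parallel _ _ _ _ h h']
    · rintro ⟨i, q⟩ j
      exact (hsol i).1.measurable q j
    · intro j hj
      obtain ⟨i, hi⟩ := exists_mem_phase hJ hj
      refine Eq.trans ?_ ((hsol i).1.amount j hi)
      congr 1
      ext x
      simp only [Set.mem_ofPred_eq]
      constructor
      · rintro ⟨⟨i', q⟩, h⟩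
        rw [hsched] at h
        obtain rfl := phase_unique hJ hi ((hsol i').1.job_mem _ _ _ h)
        exact ⟨q, h⟩
      · rintro ⟨q, h⟩
        exact ⟨(i, q), h⟩
  · calc (((double A).machines J).ncard : ℝ)
        ≤ ((∑ i ∈ I, (Prod.mk i '' (A (phaseGuess J i)).machines (phase J i)).ncard : ℕ) : ℝ) := by
          exact_mod_cast (Set.ncard_le_ncard hsub hfin).trans (Finset.set_ncard_biUnion_le _ _)
      _ ≤ ∑ i ∈ I, c * phaseGuess J i := by
          push_cast
          refine Finset.sum_le_sum fun i hi => ?_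
          refine le_trans ?_ ((hsol i).2.2.2.trans (hF i (Finset.mem_filter.1 hi).2))
          exact_mod_cast Set.ncard_image_le (hsol i).2.2.1
      _ ≤ c * (4 * opt J) := by
          rw [← Finset.mul_sum]
          refine mul_le_mul_of_nonneg_left ?_ hc
          exact_mod_cast sum_phaseGuess_le hJ (2 * opt J)
      _ = 4 * c * opt J := by ring

end Double

/-! ### The number of subsets -/

/-- The number `μ N` of subsets into which a set of critical jobs is split: a logarithm of
`(N + 1) ^ 2` to the base `1 / (1 - α)`. -/
noncomputable def splitNumber (α : ℝ) (N : ℕ) : ℕ :=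
  1 + ⌈2 * Real.log (N + 1) / -Real.log (1 - α)⌉₊

theorem splitNumber_mono {α : ℝ} (hα0 : 0 < α) (hα1 : α < 1) : Monotone (splitNumber α) := by
  intro N N' h
  have h0 : 0 < -Real.log (1 - α) := by
    have := Real.log_neg (show 0 < 1 - α by linarith) (by linarith)
    linarith
  have h1 : (N : ℝ) ≤ N' := by exact_mod_cast h
  rw [splitNumber, splitNumber]
  gcongr

theorem splitsEnough_splitNumber {α : ℝ} (hα0 : 0 < α) (hα1 : α < 1) :
    SplitsEnough α (splitNumber α) := by
  intro N
  refine ⟨Nat.le_add_right _ _, ?_⟩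
  have hβ : 0 < 1 - α := by linarith
  have h0 : 0 < -Real.log (1 - α) := by
    have := Real.log_neg hβ (by linarith)
    linarith
  have hN : (0 : ℝ) < (N : ℝ) + 1 := by positivity
  have h1 := Nat.le_ceil (2 * Real.log ((N : ℝ) + 1) / -Real.log (1 - α))
  rw [div_le_iff₀ h0] at h1
  rw [splitNumber, Nat.add_sub_cancel_left, one_div, ← Real.log_le_log_iff (by positivity)
    (by positivity), Real.log_pow, Real.log_inv, Real.log_pow]
  push_cast
  linarith

theorem splitNumber_le {α : ℝ} (hα0 : 0 < α) (hα1 : α < 1) {N : ℕ} (hN : 1 ≤ N) :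
    (splitNumber α N : ℝ) ≤ (2 / Real.log 2 + 2 / -Real.log (1 - α)) * Real.log (N + 1) := by
  have h0 : 0 < -Real.log (1 - α) := by
    have := Real.log_neg (show 0 < 1 - α by linarith) (by linarith)
    linarith
  have h2 : 0 < Real.log 2 := Real.log_pos (by norm_num)
  have hN' : (1 : ℝ) ≤ N := by exact_mod_cast hN
  have h3 : Real.log 2 ≤ Real.log (N + 1) := Real.log_le_log (by norm_num) (by linarith)
  have h4 := (Nat.ceil_lt_add_one (a := 2 * Real.log ((N : ℝ) + 1) / -Real.log (1 - α))
    (div_nonneg (by linarith) h0.le)).le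
  have h5 : 2 ≤ 2 / Real.log 2 * Real.log (N + 1) := by
    rw [div_mul_eq_mul_div, le_div_iff₀ h2]
    linarith
  rw [splitNumber]
  push_cast
  have h6 : 2 / -Real.log (1 - α) * Real.log (N + 1) =
    2 * Real.log ((N : ℝ) + 1) / -Real.log (1 - α) := by ring
  rw [add_mul, h6]
  linarith


/-! ### The competitive ratio -/

/-- The constant of the competitive ratio of the semi-online algorithm. -/
noncomputable def ratio (α lam : ℝ) : ℝ :=
  (lam / (1 - α) ^ 2 + 1) / Real.log 2 +
    (6 / α + 1) * (2 / Real.log 2 + 2 / -Real.log (1 - α))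

theorem machines_le_ratio {α lam : ℝ} (hα0 : 0 < α) (hα1 : α < 1) (hlam : 0 ≤ lam) {m n N : ℕ}
    (hm : 1 ≤ m) (hn : n ≤ N) (hN : 1 ≤ N) :
    lam * m / (1 - α) ^ 2 + 1 + (6 * m / α + 1) * splitNumber α n ≤
      ratio α lam * Real.log (N + 1) * m := by
  have hβ : 0 < 1 - α := by linarith
  have h2 : 0 < Real.log 2 := Real.log_pos (by norm_num)
  have hm' : (1 : ℝ) ≤ m := by exact_mod_cast hm
  have hN' : (1 : ℝ) ≤ N := by exact_mod_cast hN
  have h3 : Real.log 2 ≤ Real.log (N + 1) := Real.log_le_log (by norm_num) (by linarith)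
  have h4 : (splitNumber α n : ℝ) ≤ splitNumber α N := by
    exact_mod_cast splitNumber_mono hα0 hα1 hn
  have h5 := h4.trans (splitNumber_le hα0 hα1 hN)
  set c := 2 / Real.log 2 + 2 / -Real.log (1 - α)
  have h6 : 1 ≤ Real.log (N + 1) / Real.log 2 := by rwa [le_div_iff₀ h2, one_mul]
  have h7 : 0 ≤ lam / (1 - α) ^ 2 + 1 := by positivity
  calc lam * m / (1 - α) ^ 2 + 1 + (6 * m / α + 1) * splitNumber α n
      ≤ (lam / (1 - α) ^ 2 + 1) * m + (6 / α + 1) * m * splitNumber α n := by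
        have e1 : lam * m / (1 - α) ^ 2 = lam / (1 - α) ^ 2 * m := by ring
        have e2 : 6 * m / α + 1 ≤ (6 / α + 1) * m := by
          have : 6 * m / α = 6 / α * m := by ring
          linarith
        have := mul_le_mul_of_nonneg_right e2 (Nat.cast_nonneg (α := ℝ) (splitNumber α n))
        linarith
    _ ≤ (lam / (1 - α) ^ 2 + 1) * m * (Real.log (N + 1) / Real.log 2) +
          (6 / α + 1) * m * (c * Real.log (N + 1)) := by
        refine add_le_add ?_ ?_
        · exact le_mul_of_one_le_right (by positivity) h6
        · gcongr
    _ = ratio α lam * Real.log (N + 1) * m := by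
        rw [ratio]
        ring

end MachineMin

open MachineMin in
theorem mainTheorem1 (α : ℝ) (hα0 : 0 < α) (hα1 : α < 1) :
    ∃ (μ : ℕ → ℕ) (lam C : ℝ),
      (∀ N : ℕ, 1 ≤ N → 1 ≤ μ N ∧ (μ N : ℝ) ≤ C * Real.log (N + 1)) ∧
      ∀ pick : ℕ → ℕ → Finset ℕ → ℕ, MachineMin.IsChoiceRule pick →
        -- the semi-online algorithm, for every given upper bound `m` on the optimum
        (∀ m : ℕ, (MachineMin.semiOnline α μ lam pick m).IsOnline) ∧
        (∀ (J : MachineMin.Instance) (m : ℕ), MachineMin.Admissible J → J.jobs.Nonempty →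
          MachineMin.opt J ≤ m →
            (∀ t : ℕ, ((MachineMin.critState J α μ pick t).parts.length : ℝ) ≤ C * m) ∧
            MachineMin.FeasibleOn (MachineMin.safeInstance J α μ pick) ⌊lam * m⌋₊ ∧
            (MachineMin.semiOnline α μ lam pick m).SolvesWith J
              (C * Real.log (J.jobs.card + 1) * m)) ∧
        -- the online algorithm, obtained by doubling
        (MachineMin.double (MachineMin.semiOnline α μ lam pick)).IsOnline ∧
        (∀ J : MachineMin.Instance, MachineMin.Admissible J → J.jobs.Nonempty →
          (MachineMin.double (MachineMin.semiOnline α μ lam pick)).SolvesWith J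
            (C * Real.log (J.jobs.card + 1) * MachineMin.opt J)) := by
  have h2 : 0 < Real.log 2 := Real.log_pos (by norm_num)
  have h0 : 0 < -Real.log (1 - α) := by
    have := Real.log_neg (show 0 < 1 - α by linarith) (by linarith)
    linarith
  have hE := edfFactor_nonneg hα1
  obtain ⟨lam, hlam⟩ : ∃ lam, lam = edfFactor α + 1 := ⟨_, rfl⟩
  have hlam0 : 0 ≤ lam := by linarith
  obtain ⟨c, hc⟩ : ∃ c, c = 2 / Real.log 2 + 2 / -Real.log (1 - α) := ⟨_, rfl⟩
  have hc0 : 0 ≤ c := by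
    rw [hc]
    positivity
  have hR : 0 ≤ ratio α lam := by
    have hβ : 0 < 1 - α := by linarith
    rw [ratio]
    positivity
  obtain ⟨C, hC⟩ : ∃ C, C = 4 * ratio α lam + (6 / α + 1) + c := ⟨_, rfl⟩
  have hα6 : 0 < 6 / α := by positivity
  have hlog : ∀ N : ℕ, 0 ≤ Real.log ((N : ℝ) + 1) := fun N =>
    Real.log_nonneg (by linarith [(Nat.cast_nonneg N : (0 : ℝ) ≤ N)])
  have hμ := splitsEnough_splitNumber hα0 hα1
  have hμm := splitNumber_mono hα0 hα1
  refine ⟨splitNumber α, lam, C, fun N hN => ⟨(hμ N).1, ?_⟩, fun pick hpick => ?_⟩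
  · refine (splitNumber_le hα0 hα1 hN).trans (mul_le_mul_of_nonneg_right ?_ (hlog N))
    rw [← hc]
    linarith
  have hS : ∀ J, Admissible J → ∀ t, CritInv J α (splitNumber α) t
      (critState J α (splitNumber α) pick t) :=
    fun J hJ => critInv_critState hα0 hα1 hμ hpick hJ
  have hsolve : ∀ (J : Instance) (m : ℕ), Admissible J → opt J ≤ m →
      (semiOnline α (splitNumber α) lam pick m).SolvesWith J
        (lam * m / (1 - α) ^ 2 + 1 + (6 * m / α + 1) * splitNumber α J.jobs.card) :=
    fun J m hJ hm => semiOnline_solvesWith (hS J hJ) hα0 hα1 hμ hμm hJ (by linarith) hm le_rfl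
  have hon := fun m => isOnline_semiOnline (pick := pick) hα0 hα1 hμ hpick lam m
  refine ⟨hon, fun J m hJ hne hm => ⟨fun t => ?_, ?_, ?_⟩, isOnline_double hon hsolve,
    fun J hJ hne => ?_⟩
  · have h1 : (1 : ℝ) ≤ m := by exact_mod_cast (hJ.one_le_opt hne).trans hm
    have h3 : (opt J : ℝ) ≤ m := by exact_mod_cast hm
    refine (hS J hJ t).length_parts.trans ?_
    calc 6 * opt J / α + 1 = 6 / α * opt J + 1 := by ring
      _ ≤ 6 / α * m + 1 * m := by
          rw [one_mul]
          gcongr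
      _ = (6 / α + 1) * m := by ring
      _ ≤ C * m := by
          gcongr
          linarith
  · have h1 : (1 : ℝ) ≤ m := by exact_mod_cast (hJ.one_le_opt hne).trans hm
    have h3 : (opt J : ℝ) ≤ m := by exact_mod_cast hm
    refine Instance.feasibleOn_of_edf fun j hj =>
      edfRem_safeInstance (hS J hJ) hα0 hα1 hμ hJ ?_ hj
    -- The summand `1` of `lam` makes up for the rounding.
    have h4 := Nat.lt_floor_add_one (lam * m)
    have h5 : edfFactor α * opt J ≤ edfFactor α * m := by gcongr
    have h6 : lam * m = edfFactor α * m + m := by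
      rw [hlam]
      ring
    linarith
  · obtain ⟨h1, h3, h4, h5⟩ := hsolve J m hJ hm
    refine ⟨h1, h3, h4, h5.trans ?_⟩
    refine (machines_le_ratio hα0 hα1 hlam0 ((hJ.one_le_opt hne).trans hm) le_rfl
      (Finset.card_pos.2 hne)).trans ?_
    have := hlog J.jobs.card
    gcongr
    linarith
  · have hl := hlog J.jobs.card
    obtain ⟨h1, h3, h4, h5⟩ := double_solvesWith
      (c := ratio α lam * Real.log (J.jobs.card + 1)) hJ hsolve (by positivity) fun i hi =>
        machines_le_ratio hα0 hα1 hlam0 (by have := lt_phaseGuess hJ hi; omega)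
          (Finset.card_le_card (subInstance_phase J i).1) (Finset.card_pos.2 hne)
    refine ⟨h1, h3, h4, h5.trans ?_⟩
    have h6 : 4 * ratio α lam ≤ C := by linarith
    calc 4 * (ratio α lam * Real.log (J.jobs.card + 1)) * opt J
        = 4 * ratio α lam * Real.log (J.jobs.card + 1) * opt J := by ring
      _ ≤ C * Real.log (J.jobs.card + 1) * opt J := by gcongr
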